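/- \textbf{Setting.} A network is a directed graph $G=(\mathcal V,\mathcal E)$ with finite node set $\mathcal V$ and $\mathcal E\subseteq\mathcal V\times\mathcal V$; each edge $e=(u,v)$ carries a memoryless channel from $u$ to $v$ with finite input alphabet $\mathsf X_e$, finite output alphabet $\mathsf Y_e$ and transition law $K_e$; the channels of different edges are independent. Node $v$ observes a random variable $W_v$ with values in a measurable space $\mathsf W_v$; the vector $W=(W_v)_{v\in\mathcal V}$ has an arbitrary joint law $\mathbb P_W$. The nodes want to estimate $Z=f(W)$, where $f:\prod_v\mathsf W_v\to\mathsf Z$ is measurable and $\mathsf Z$ is a standard Borel space. All logarithms are binary. A $T$-step algorithm ($T\in\{0,1,2,\dots\}$) consists of deterministic measurable encoders $\varphi_{v,t}$ and estimators $\psi_v$, for $v\in\mathcal V$ and $1\le t\le T$. At time $t$ node $v$ computes one input symbol for each edge leaving $v$ as $\varphi_{v,t}(W_v,Y_v^{t-1})$, where $Y_v^{t-1}$ denotes all channel outputs received by $v$ at times $1,\dots,t-1$; the symbols are sent over the channels, whose outputs depend on the past and on $W$ only through the current inputs. After time $T$, node $v$ forms the estimate $\widehat Z_v=\psi_v(W_v,Y_v^T)\in\mathsf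 Z$. For a measurable distortion function $d:\mathsf Z\times\mathsf Z\to[0,\infty)$ and $\varepsilon\ge 0$ let $$T_{\max}(\varepsilon)=\inf\Big\{T:\ \text{some $T$-step algorithm satisfies } \max_{v\in\mathcal V}\mathbb E\big[d(Z,\widehat Z_v)\big]\le\varepsilon\Big\},\qquad \inf\varnothing=\infty .$$ For $\mathcal S\subseteq\mathcal V$ let $W_{\mathcal S}=(W_v)_{v\in\mathcal S}$ and let $C_{\mathcal S}=\sum C_e$ be the cutset capacity, the sum being over the edges $e=(u,v)\in\mathcal E$ with $u\notin\mathcal S$, $v\in\mathcal S$, where $C_e$ is the Shannon capacity of $K_e$. Let $$R_Z(\varepsilon)=\inf_{\mathbb P_{\widehat Z|Z}:\ \mathbb E[d(Z,\widehat Z)]\le\varepsilon} I(Z;\widehat Z)$$ be the rate-distortion function of $Z$ (with $\inf\varnothing=\infty$). For real $Z$, $h(Z|W_{\mathcal S})=-\mathbb E[\log p(Z|W_{\mathcal S})]\in[-\infty,\infty]$ is the conditional differential entropy, where $p(\cdot|W_{\mathcal S})$ is the conditional Lebesgue density of $Z$ given $W_{\mathcal S}$; it is $-\infty$ if no conditional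 density exists. \textbf{Theorem.} For an arbitrary network and every $\varepsilon\ge 0$, $$T_{\max}(\varepsilon)\ \ge\ \max_{\varnothing\ne\mathcal S\subseteq\mathcal V}\ \frac{R_Z(\varepsilon)-I(Z;W_{\mathcal S})}{C_{\mathcal S}} .$$ If $\mathsf Z=\mathbb R$, the law of $Z$ is absolutely continuous with respect to Lebesgue measure, and $d(z,\widehat z)=(z-\widehat z)^2$, then $$T_{\max}(\varepsilon)\ \ge\ \max_{\varnothing\ne\mathcal S\subseteq\mathcal V}\ \frac{1}{C_{\mathcal S}}\left(h(Z|W_{\mathcal S})+\frac12\log\frac{1}{2\pi e\,\varepsilon}\right),$$ where $\log\frac10=+\infty$. Here $a/C_{\mathcal S}$ for $C_{\mathcal S}=0$ means $+\infty$, $0$ or $-\infty$ according to whether $a>0$, $a=0$ or $a<0$, and an undefined difference $\infty-\infty$ is read as $-\infty$. -/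

import Mathlib

open MeasureTheory ProbabilityTheory
open scoped ENNReal NNReal

universe u v w z

/-- Binary logarithm on `[0, ∞]`, with `log2 0 = -∞` and `log2 ∞ = ∞`. -/
noncomputable def log2 (x : ℝ≥0∞) : EReal := ENNReal.log x / ((Real.log 2 : ℝ) : EReal)

/-- Mutual information `I(A; B)` in bits, where `ρ` is the joint law of `(A, B)`. -/
noncomputable def mutualInfo {α : Type*} {β : Type*} [MeasurableSpace α] [MeasurableSpace β]
    (ρ : Measure (α × β)) : ℝ≥0∞ :=
  InformationTheory.klDiv ρ (ρ.fst.prod ρ.snd) / ENNReal.ofReal (Real.log 2)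

/-- Shannon capacity (bits per use) of the channel with transition law `K`. -/
noncomputable def capacity {α : Type*} {β : Type*} [MeasurableSpace α] [MeasurableSpace β]
    (K : Kernel α β) : ℝ≥0∞ :=
  ⨆ p : ProbabilityMeasure α, mutualInfo ((p : Measure α) ⊗ₘ K)

/-- Rate-distortion function of a source with law `μ`: the infimum of `I(Z; Ẑ)` over all
conditional laws of `Ẑ` given `Z` with expected distortion at most `ε`. -/
noncomputable def rateDistortion {Z : Type*} [MeasurableSpace Z] (d : Z → Z → ℝ≥0)
    (μ : Measure Z) (ε : ℝ≥0) : ℝ≥0∞ :=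
  ⨅ (κ : Kernel Z Z) (_ : IsMarkovKernel κ)
    (_ : ∫⁻ p, (d p.1 p.2 : ℝ≥0∞) ∂(μ ⊗ₘ κ) ≤ (ε : ℝ≥0∞)), mutualInfo (μ ⊗ₘ κ)

open Classical in
/-- Conditional differential entropy `h(Z | U) = -E[log2 p(Z | U)]` in bits of a real random
variable `Z` given `U`, where `ρ` is the joint law of `(Z, U)`. The conditional density `p(z | u)`
with respect to Lebesgue measure is the density of `ρ` with respect to `Lebesgue ⊗ law of U`.
The value is `-∞` if there is no conditional density, and also (by `∞ - ∞ = -∞` in `EReal`) if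
the positive and the negative part of `-log2 p(Z | U)` both have infinite expectation. -/
noncomputable def condDiffEntropy {β : Type*} [MeasurableSpace β] (ρ : Measure (ℝ × β)) : EReal :=
  if ρ ≪ (volume : Measure ℝ).prod ρ.snd then
    ((∫⁻ x, (-log2 (ρ.rnDeriv ((volume : Measure ℝ).prod ρ.snd) x)).toENNReal ∂ρ : ℝ≥0∞) : EReal)
      - ((∫⁻ x, (log2 (ρ.rnDeriv ((volume : Measure ℝ).prod ρ.snd) x)).toENNReal ∂ρ : ℝ≥0∞) : EReal)
  else ⊥

/-- A network with node set `V`: a directed graph, and on each edge `e = (u, v)` a channel from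
`u` to `v` with finite input alphabet `In e`, finite output alphabet `Out e` (both carrying the
discrete σ-algebra) and transition law `K e`. -/
structure Network (V : Type v) where
  edges : Finset (V × V)
  In : edges → Type u
  Out : edges → Type u
  [fintypeIn : ∀ e, Fintype (In e)]
  [fintypeOut : ∀ e, Fintype (Out e)]
  [measurableSpaceIn : ∀ e, MeasurableSpace (In e)]
  [measurableSpaceOut : ∀ e, MeasurableSpace (Out e)]
  [discreteIn : ∀ e, DiscreteMeasurableSpace (In e)]
  [discreteOut : ∀ e, DiscreteMeasurableSpace (Out e)]
  K : ∀ e, Kernel (In e) (Out e)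
  [markov : ∀ e, IsMarkovKernel (K e)]

attribute [instance] Network.fintypeIn Network.fintypeOut Network.measurableSpaceIn
  Network.measurableSpaceOut Network.discreteIn Network.discreteOut Network.markov

namespace Network

variable {V : Type v} (N : Network.{u} V)

/-- The input alphabet of node `v`: one input symbol for each edge leaving `v`. -/
abbrev NodeIn (v : V) : Type _ := ∀ e : {e : N.edges // e.1.1 = v}, N.In e.1

/-- The output alphabet at node `v`: one output symbol for each edge entering `v`. -/
abbrev NodeOut (v : V) : Type _ := ∀ e : {e : N.edges // e.1.2 = v}, N.Out e.1

/-- The outputs of all the channels of the network at one time. -/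
abbrev AllOut : Type _ := ∀ e : N.edges, N.Out e

/-- The part of the outputs that is received by node `v`. -/
def received {N : Network.{u} V} (v : V) (y : N.AllOut) : N.NodeOut v := fun e => y e.1

/-- Cutset capacity: the sum of the capacities of the edges from the complement of `S` to `S`. -/
noncomputable def cutCapacity [DecidableEq V] (S : Finset V) : ℝ≥0∞ :=
  ∑ e : N.edges, if e.1.1 ∉ S ∧ e.1.2 ∈ S then capacity (N.K e) else 0

/-- `T`-step algorithms. The times `1, …, T` are indexed by `t : Fin T` starting from zero, so
that the encoder at index `t` sees the `t` earlier outputs received by its node. -/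
structure Algorithm (W : V → Type w) [∀ v, MeasurableSpace (W v)] (Z : Type z)
    [MeasurableSpace Z] (T : ℕ) where
  enc : ∀ (v : V) (t : Fin T), W v × (Fin t → N.NodeOut v) → N.NodeIn v
  est : ∀ v : V, W v × (Fin T → N.NodeOut v) → Z
  measurable_enc : ∀ v t, Measurable (enc v t)
  measurable_est : ∀ v, Measurable (est v)

namespace Algorithm

variable {N} {W : V → Type w} [∀ v, MeasurableSpace (W v)] {Z : Type z} [MeasurableSpace Z] {T : ℕ}
  (A : N.Algorithm W Z T)

/-- The symbol that is sent over edge `e` at time index `t` when the observations are `x` and the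
channel outputs are `y` (only the outputs before `t` matter). -/
def sent (x : ∀ v, W v) (y : Fin T → N.AllOut) (t : Fin T) (e : N.edges) : N.In e :=
  A.enc e.1.1 t (x e.1.1, fun s => received e.1.1 (y (Fin.castLE t.isLt.le s))) ⟨e, rfl⟩

/-- The conditional probability of the channel outputs `y` up to time `T` given the observations
`x`: the channels are memoryless and independent across edges. -/
noncomputable def outputProb (x : ∀ v, W v) (y : Fin T → N.AllOut) : ℝ≥0∞ :=
  ∏ t : Fin T, ∏ e : N.edges, N.K e (A.sent x y t e) {y t e}

/-- The joint law of the observations and of all channel outputs up to time `T`. -/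
noncomputable def jointLaw [DecidableEq V] (P : Measure (∀ v, W v)) :
    Measure ((∀ v, W v) × (Fin T → N.AllOut)) :=
  ∑ y : Fin T → N.AllOut, (P.withDensity fun x => A.outputProb x y).map fun x => (x, y)

/-- The estimate of node `v` at time `T`. -/
def estimate (v : V) (ω : (∀ v, W v) × (Fin T → N.AllOut)) : Z :=
  A.est v (ω.1 v, fun s => received v (ω.2 s))

/-- The expected distortion of the estimate of node `v`, when `f` is to be computed. -/
noncomputable def expectedDistortion [DecidableEq V] (P : Measure (∀ v, W v))
    (f : (∀ v, W v) → Z) (d : Z → Z → ℝ≥0) (v : V) : ℝ≥0∞ :=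
  ∫⁻ ω, (d (f ω.1) (A.estimate v ω) : ℝ≥0∞) ∂(A.jointLaw P)

end Algorithm

/-- The maximum `ε`-computation time, equal to `∞` if no algorithm reaches the accuracy `ε`. -/
noncomputable def Tmax [DecidableEq V] {W : V → Type w} [∀ v, MeasurableSpace (W v)]
    {Z : Type z} [MeasurableSpace Z] (P : Measure (∀ v, W v))
    (f : (∀ v, W v) → Z) (d : Z → Z → ℝ≥0) (ε : ℝ≥0) : ℕ∞ :=
  ⨅ (T : ℕ) (_ : ∃ A : N.Algorithm W Z T, ∀ v, A.expectedDistortion P f d v ≤ (ε : ℝ≥0∞)),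
    (T : ℕ∞)

end Network

/-- The quotient `a / C` of `a` by `C ≥ 0`, with the convention that for `C = 0` it is `∞`, `0` or
`-∞` according to the sign of `a` (the inverse is the one of `[0, ∞]`, where `0⁻¹ = ∞`). -/
noncomputable def perCapacity (a : EReal) (C : ℝ≥0∞) : EReal := a * ((C⁻¹ : ℝ≥0∞) : EReal)

/-! ### The output law of an optimal input of a finite channel -/

section CapacityAchieving

variable {α β : Type*} [Fintype α] [Fintype β]

/-! The proof is a change of measure across one cut. Fix a nonempty `S`, a node `v` in `S` and an
algorithm. In a comparison system each channel entering `S` from outside is replaced by noise of a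
fixed law `q e`, independent of everything else. There the estimate of `v` is a function of the
observations in `S` and of randomness that carries no information on the remaining observations, so
it is conditionally independent of `Z` given those in `S`.

For `q e` one takes the output law of a capacity-achieving input: the divergence from it of every
row of the channel is at most the capacity (`exists_finMutualInfo_center`,
`exists_capacity_center`). Hence, whatever is sent and however the past outputs are used, the
log-likelihood ratio `cutLLR` between the two systems has expectation at most `T` times the cutset
capacity, in nats (`integral_cutLLR_le`).

Let `m` be a reference measure for `Z`, let `r` be the density of the law of `Z` and the
observations in `S` against `m` times the law of the latter, and let `a (z, z')` be a subprobability
density in `z` for each `z'`. Conditional independence gives `E[a(Z, Ẑ) r⁻¹ exp(-cutLLR)] ≤ 1`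
(`lintegral_mul_exp_neg_cutLLR_le_one`). Taking logarithms inside the expectation, `E log a(Z, Ẑ) ≤
E log r + E cutLLR`.

Two choices give the two bounds. If `m` is the law of `Z` and `a` the density of the law of `(Z, Ẑ)`
against the product of its marginals, this is `I(Z; Ẑ) ≤ I(Z; W_S) + T C_S`
(`klDiv_joint_estimate_le`), and `I(Z; Ẑ)` is at least the rate-distortion function. If `m` is
Lebesgue measure and `a` is the Gaussian density of variance `ε` around `z'`, it is the entropy
bound (`condDiffEntropy_le`). Much of the remaining work is integrability, needed to split the
expectation of the sum of logarithms. -/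

/-- The mutual information in nats of the input `p` and the output of the channel with transition
matrix `k`, written as the difference of output entropy and conditional entropy. -/
noncomputable def finMutualInfo (k : α → β → ℝ) (p : α → ℝ) : ℝ :=
  ∑ o, Real.negMulLog (∑ x, p x * k x o) - ∑ x, p x * ∑ o, Real.negMulLog (k x o)

lemma continuous_finMutualInfo (k : α → β → ℝ) : Continuous (finMutualInfo k) := by
  unfold finMutualInfo
  fun_prop

/-- Gibbs' inequality for finite distributions. -/
lemma sum_mul_log_le_of_sum_eq (a b : β → ℝ) (ha : ∀ o, 0 ≤ a o) (hb : ∀ o, 0 ≤ b o)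
    (hab : ∀ o, b o = 0 → a o = 0) (hsum : ∑ o, a o = ∑ o, b o) :
    ∑ o, a o * Real.log (b o) ≤ ∑ o, a o * Real.log (a o) := by
  have h : ∀ o, a o * Real.log (b o) - a o * Real.log (a o) ≤ b o - a o := by
    intro o
    rcases (ha o).eq_or_lt with h0 | h0
    · simp [← h0, hb o]
    · have hb0 : 0 < b o := (hb o).lt_of_ne fun h => h0.ne' (hab o h.symm)
      have := Real.log_le_sub_one_of_pos (div_pos hb0 h0)
      rw [Real.log_div hb0.ne' h0.ne'] at this
      have h2 := mul_le_mul_of_nonneg_left this h0.le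
      have h3 : a o * (b o / a o - 1) = b o - a o := by field_simp
      linarith
  have := Finset.sum_le_sum fun o (_ : o ∈ Finset.univ) => h o
  simp only [Finset.sum_sub_distrib] at this
  linarith

variable [DecidableEq α]

/-- First-order optimality without derivatives: compare the maximiser with its mixture with the
point mass at `x`, use Gibbs' inequality to replace the cross entropy of the old output law against
the new one, and divide by `l`. Keeping `l > 0` avoids logarithms of zero on the support of `k x`.
-/
lemma finMutualInfo_perturb (k : α → β → ℝ) (hk : ∀ x o, 0 ≤ k x o) (hk1 : ∀ x, ∑ o, k x o = 1)
    {p : α → ℝ} (hp : p ∈ stdSimplex ℝ α)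
    (hmax : ∀ p' ∈ stdSimplex ℝ α, finMutualInfo k p' ≤ finMutualInfo k p) (x : α)
    {l : ℝ} (hl : 0 < l) (hl1 : l < 1) :
    - ∑ o, k x o * Real.log ((1 - l) * (∑ x, p x * k x o) + l * k x o)
      ≤ finMutualInfo k p + ∑ o, Real.negMulLog (k x o) := by
  set q : β → ℝ := fun o => ∑ x, p x * k x o with hq
  have hq0 : ∀ o, 0 ≤ q o := fun o => Finset.sum_nonneg fun x _ => mul_nonneg (hp.1 x) (hk x o)
  have hq1 : ∑ o, q o = 1 := by
    simp only [hq]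
    rw [Finset.sum_comm]
    simp_rw [← Finset.mul_sum, hk1, mul_one]
    exact hp.2
  set ql : β → ℝ := fun o => (1 - l) * q o + l * k x o with hql
  have hpl : (1 - l) • p + l • (Pi.single x 1 : α → ℝ) ∈ stdSimplex ℝ α :=
    convex_stdSimplex ℝ α hp (single_mem_stdSimplex ℝ x) (by linarith) hl.le (by ring)
  have h1 := hmax _ hpl
  have e1 : ∀ o, ∑ x', ((1 - l) • p + l • (Pi.single x 1 : α → ℝ)) x' * k x' o = ql o := by
    intro o
    simp only [Pi.add_apply, Pi.smul_apply, smul_eq_mul, add_mul, Finset.sum_add_distrib, hql, hq,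
      Finset.mul_sum, mul_assoc]
    simp [Pi.single_apply]
  have e2 : ∑ x', ((1 - l) • p + l • (Pi.single x 1 : α → ℝ)) x' * ∑ o, Real.negMulLog (k x' o)
      = (1 - l) * (∑ x', p x' * ∑ o, Real.negMulLog (k x' o))
        + l * ∑ o, Real.negMulLog (k x o) := by
    simp only [Pi.add_apply, Pi.smul_apply, smul_eq_mul, add_mul, Finset.sum_add_distrib,
      Finset.mul_sum, mul_assoc]
    congr 1
    simp [Pi.single_apply]
  have h2 : ∑ o, q o * Real.log (ql o) ≤ ∑ o, q o * Real.log (q o) := by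
    refine sum_mul_log_le_of_sum_eq q ql hq0
      (fun o => add_nonneg (mul_nonneg (by linarith) (hq0 o)) (mul_nonneg hl.le (hk x o))) ?_ ?_
    · intro o ho
      have h1 := mul_nonneg (by linarith : 0 ≤ 1 - l) (hq0 o)
      have h2 := mul_nonneg hl.le (hk x o)
      have h3 : (1 - l) * q o = 0 := by simp only [hql] at ho; linarith
      rcases mul_eq_zero.1 h3 with h | h
      · linarith
      · exact h
    · simp only [hql, Finset.sum_add_distrib, ← Finset.mul_sum, hk1, hq1]
      ring
  have e3 : ∑ o, Real.negMulLog (ql o) = -((1 - l) * ∑ o, q o * Real.log (ql o))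
      - l * ∑ o, k x o * Real.log (ql o) := by
    simp only [Real.negMulLog, Finset.mul_sum, ← Finset.sum_neg_distrib, ← Finset.sum_sub_distrib]
    refine Finset.sum_congr rfl fun o _ => ?_
    simp only [hql]; ring
  have e4 : ∑ o, Real.negMulLog (q o) = -∑ o, q o * Real.log (q o) := by
    simp [Real.negMulLog]
  unfold finMutualInfo at h1 ⊢
  simp only [e1, e2] at h1
  rw [e3] at h1
  change _ ≤ ∑ o, Real.negMulLog (q o) - _ at h1
  change _ ≤ ∑ o, Real.negMulLog (q o) - _ + _
  rw [e4] at h1 ⊢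
  have h3 := mul_le_mul_of_nonneg_left h2 (by linarith : 0 ≤ 1 - l)
  refine le_of_mul_le_mul_left ?_ hl
  linarith

/-- The output distribution of an optimal input is a centre of the channel. -/
lemma exists_finMutualInfo_center [Nonempty α] (k : α → β → ℝ) (hk : ∀ x o, 0 ≤ k x o)
    (hk1 : ∀ x, ∑ o, k x o = 1) :
    ∃ p ∈ stdSimplex ℝ α, ∀ x, (∀ o, ∑ x', p x' * k x' o = 0 → k x o = 0) ∧
      ∑ o, k x o * (Real.log (k x o) - Real.log (∑ x', p x' * k x' o)) ≤ finMutualInfo k p := by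
  obtain ⟨p, hp, hmax⟩ := (isCompact_stdSimplex ℝ α).exists_isMaxOn
    ⟨_, single_mem_stdSimplex ℝ (Classical.arbitrary α)⟩ (continuous_finMutualInfo k).continuousOn
  refine ⟨p, hp, fun x => ?_⟩
  set q : β → ℝ := fun o => ∑ x', p x' * k x' o with hq
  have hq0 : ∀ o, 0 ≤ q o := fun o => Finset.sum_nonneg fun x _ => mul_nonneg (hp.1 x) (hk x o)
  have hq1 : ∑ o, q o = 1 := by
    simp only [hq]
    rw [Finset.sum_comm]
    simp_rw [← Finset.mul_sum, hk1, mul_one]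
    exact hp.2
  have hk_le : ∀ o, k x o ≤ 1 := fun o =>
    (hk1 x) ▸ Finset.single_le_sum (fun o _ => hk x o) (Finset.mem_univ o)
  have hq_le : ∀ o, q o ≤ 1 := fun o =>
    hq1 ▸ Finset.single_le_sum (fun o _ => hq0 o) (Finset.mem_univ o)
  have hpert : ∀ l : ℝ, 0 < l → l < 1 → - ∑ o, k x o * Real.log ((1 - l) * q o + l * k x o)
      ≤ finMutualInfo k p + ∑ o, Real.negMulLog (k x o) :=
    fun l hl hl1 => finMutualInfo_perturb k hk hk1 hp (fun p' hp' => hmax hp') x hl hl1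
  -- If `q o = 0 < k x o`, the term at `o` in the perturbation bound tends to `+∞` as `l → 0`. The
  -- other terms are nonnegative because the logarithms have arguments in `[0, 1]`, so the uniform
  -- bound `M` fails.
  have hac : ∀ o, q o = 0 → k x o = 0 := by
    intro o ho
    by_contra hne
    have hpos : 0 < k x o := (hk x o).lt_of_ne (Ne.symm hne)
    set M := finMutualInfo k p + ∑ o, Real.negMulLog (k x o)
    have hb : ∀ l : ℝ, 0 < l → l < 1 → -(k x o * Real.log (l * k x o)) ≤ M := by
      intro l hl hl1
      refine le_trans ?_ (hpert l hl hl1)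
      rw [← Finset.sum_neg_distrib]
      have := Finset.single_le_sum (f := fun o => -(k x o * Real.log ((1 - l) * q o + l * k x o)))
        (fun o _ => ?_) (Finset.mem_univ o)
      · simpa [ho] using this
      · rw [neg_nonneg]
        refine mul_nonpos_of_nonneg_of_nonpos (hk x o) (Real.log_nonpos ?_ ?_)
        · exact add_nonneg (mul_nonneg (by linarith) (hq0 o)) (mul_nonneg hl.le (hk x o))
        · nlinarith [hq_le o, hk_le o]
    have ht : Filter.Tendsto (fun l : ℝ => -(k x o * Real.log (l * k x o)))
        (nhdsWithin 0 (Set.Ioi 0)) Filter.atTop := by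
      have h1 : Filter.Tendsto (fun l : ℝ => l * k x o) (nhdsWithin 0 (Set.Ioi 0))
          (nhdsWithin 0 (Set.Ioi 0)) := by
        refine tendsto_nhdsWithin_iff.2 ⟨?_, ?_⟩
        · have : Continuous fun l : ℝ => l * k x o := by fun_prop
          simpa using (this.tendsto 0).mono_left nhdsWithin_le_nhds
        · filter_upwards [self_mem_nhdsWithin] with l hl using mul_pos hl hpos
      have h2 := Real.tendsto_log_nhdsGT_zero.comp h1
      have h3 := Filter.Tendsto.const_mul_atBot hpos h2
      exact Filter.tendsto_neg_atBot_atTop.comp h3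
    have hev := (ht.eventually_gt_atTop M).and (Ioo_mem_nhdsGT (zero_lt_one' ℝ))
    obtain ⟨l, h1, h2, h3⟩ := hev.exists
    exact absurd (hb l h2 h3) (not_le.2 h1)
  refine ⟨hac, ?_⟩
  -- Where `q o` vanishes so does `k x o`, hence the limit `l → 0` can be taken term by term.
  have hlim : Filter.Tendsto (fun l : ℝ => - ∑ o, k x o * Real.log ((1 - l) * q o + l * k x o))
      (nhdsWithin 0 (Set.Ioi 0)) (nhds (- ∑ o, k x o * Real.log (q o))) := by
    refine (tendsto_finsetSum _ fun o _ => ?_).neg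
    by_cases h : q o = 0
    · simp [hac o h]
    · refine Filter.Tendsto.const_mul _ (Filter.Tendsto.mono_left ?_ nhdsWithin_le_nhds)
      have hc : ContinuousAt (fun l : ℝ => Real.log ((1 - l) * q o + l * k x o)) 0 :=
        ContinuousAt.log (by fun_prop) (by simpa using h)
      simpa using hc.tendsto
  have hle := le_of_tendsto hlim (b := finMutualInfo k p + ∑ o, Real.negMulLog (k x o)) (by
    filter_upwards [Ioo_mem_nhdsGT (zero_lt_one' ℝ)] with l hl using hpert l hl.1 hl.2)
  have e : ∑ o, k x o * (Real.log (k x o) - Real.log (q o))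
      = - ∑ o, Real.negMulLog (k x o) + - ∑ o, k x o * Real.log (q o) := by
    simp only [Real.negMulLog, ← Finset.sum_neg_distrib, ← Finset.sum_add_distrib]
    exact Finset.sum_congr rfl fun o _ => by ring
  rw [e]
  linarith

end CapacityAchieving

/-! ### From the entropy formula to the capacity of a kernel -/

section CapacityBound

variable {α : Type*} {β : Type*} [Fintype α] [Fintype β] [MeasurableSpace α] [MeasurableSpace β]
  [DiscreteMeasurableSpace α] [DiscreteMeasurableSpace β]

lemma ofReal_finMutualInfo_le_capacity (K : Kernel α β) [IsMarkovKernel K] {p : α → ℝ}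
    (hp : p ∈ stdSimplex ℝ α) :
    ENNReal.ofReal (finMutualInfo (fun x o => (K x).real {o}) p)
      ≤ capacity K * ENNReal.ofReal (Real.log 2) := by
  classical
  set k : α → β → ℝ := fun x o => (K x).real {o} with hk
  set μ : Measure α := ∑ x, ENNReal.ofReal (p x) • Measure.dirac x with hμ
  have hμx : ∀ x, μ {x} = ENNReal.ofReal (p x) := by
    intro x
    simp only [hμ, Measure.coe_finsetSum, Finset.sum_apply, Measure.smul_apply, smul_eq_mul,
      Measure.dirac_apply, Set.indicator_apply, Set.mem_singleton_iff, Pi.one_apply]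
    simp
  have : IsProbabilityMeasure μ := by
    constructor
    simp only [hμ, Measure.coe_finsetSum, Finset.sum_apply, Measure.smul_apply, smul_eq_mul,
      measure_univ, mul_one]
    rw [← ENNReal.ofReal_sum_of_nonneg fun x _ => hp.1 x, hp.2, ENNReal.ofReal_one]
  have hlog2 : ENNReal.ofReal (Real.log 2) ≠ 0 := by
    simpa using Real.log_pos one_lt_two
  have hle : mutualInfo (μ ⊗ₘ K) ≤ capacity K := le_iSup (fun p : ProbabilityMeasure α =>
    mutualInfo ((p : Measure α) ⊗ₘ K)) ⟨μ, inferInstance⟩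
  refine le_trans ?_ (mul_le_mul_left hle _)
  unfold mutualInfo
  rw [ENNReal.div_mul_cancel hlog2 ENNReal.ofReal_ne_top]
  set ρ := μ ⊗ₘ K with hρ
  set ν := ρ.fst.prod ρ.snd with hν
  by_cases htop : InformationTheory.klDiv ρ ν = ⊤
  · rw [htop]; exact le_top
  obtain ⟨hac, hint⟩ := InformationTheory.klDiv_ne_top_iff.1 htop
  rw [InformationTheory.klDiv_of_ac_of_integrable hac hint]
  refine ENNReal.ofReal_le_ofReal ?_
  have hkK : ∀ x o, ENNReal.ofReal (k x o) = K x {o} := fun x o =>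
    ENNReal.ofReal_toReal (measure_ne_top _ _)
  have hρx : ∀ x o, ρ {(x, o)} = ENNReal.ofReal (p x * k x o) := by
    intro x o
    rw [ENNReal.ofReal_mul (hp.1 x), hρ, ← Set.singleton_prod_singleton,
      Measure.compProd_apply_prod (measurableSet_singleton _) (measurableSet_singleton _),
      lintegral_singleton, hμx, hkK, mul_comm]
  have hk0 : ∀ x o, 0 ≤ k x o := fun x o => measureReal_nonneg
  set q : β → ℝ := fun o => ∑ x, p x * k x o with hq
  have hq0 : ∀ o, 0 ≤ q o := fun o => Finset.sum_nonneg fun x _ => mul_nonneg (hp.1 x) (hk0 x o)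
  have hsnd : ∀ o, ρ.snd {o} = ENNReal.ofReal (q o) := by
    intro o
    rw [hρ, Measure.snd_compProd, Measure.bind_apply (measurableSet_singleton _)
      (Kernel.aemeasurable _), lintegral_fintype, hq,
      ENNReal.ofReal_sum_of_nonneg fun x _ => mul_nonneg (hp.1 x) (hk0 x o)]
    refine Finset.sum_congr rfl fun x _ => ?_
    rw [ENNReal.ofReal_mul (hp.1 x), hμx, hkK, mul_comm]
  have hνx : ∀ x o, ν {(x, o)} = ENNReal.ofReal (p x * q o) := by
    intro x o
    rw [hν, ← Set.singleton_prod_singleton, Measure.prod_prod, hsnd, hρ, Measure.fst_compProd,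
      hμx, ENNReal.ofReal_mul (hp.1 x)]
  have hρr : ∀ x o, ρ.real {(x, o)} = p x * k x o := fun x o => by
    rw [measureReal_def, hρx, ENNReal.toReal_ofReal (mul_nonneg (hp.1 x) (hk0 x o))]
  have hderiv : ∀ x o, (ρ.rnDeriv ν (x, o)).toReal * (p x * q o) = p x * k x o := by
    intro x o
    have h1 := hρx x o
    rw [← Measure.withDensity_rnDeriv_eq ρ ν hac, withDensity_apply _ (measurableSet_singleton _),
      lintegral_singleton, hνx] at h1
    have h2 := congrArg ENNReal.toReal h1
    rwa [ENNReal.toReal_mul, ENNReal.toReal_ofReal (mul_nonneg (hp.1 x) (hq0 o)),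
      ENNReal.toReal_ofReal (mul_nonneg (hp.1 x) (hk0 x o))] at h2
  rw [integral_fintype hint]
  simp only [probReal_univ, add_sub_cancel_right, smul_eq_mul, Fintype.sum_prod_type, hρr]
  have e : finMutualInfo k p
      = ∑ x, ∑ o, p x * k x o * (Real.log (k x o) - Real.log (q o)) := by
    unfold finMutualInfo
    simp only [Real.negMulLog, mul_sub, Finset.sum_sub_distrib, Finset.mul_sum, neg_mul,
      Finset.sum_neg_distrib, mul_neg, Finset.sum_mul, sub_neg_eq_add]
    rw [Finset.sum_comm, sub_eq_add_neg, add_comm]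
    simp only [hq, mul_assoc]
  rw [e]
  refine Finset.sum_le_sum fun x _ => Finset.sum_le_sum fun o _ => le_of_eq ?_
  -- The density is determined only at atoms of the reference product measure; points without joint
  -- mass contribute zero on both sides.
  by_cases h0 : p x * k x o = 0
  · simp [h0]
  congr 1
  have hx : p x ≠ 0 := left_ne_zero_of_mul h0
  have hko : k x o ≠ 0 := right_ne_zero_of_mul h0
  have hqo : q o ≠ 0 := fun h => h0 (by rw [← hderiv, h]; simp)
  rw [llr_def, ← Real.log_div hko hqo]
  congr 1
  rw [div_eq_iff hqo]
  have := hderiv x o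
  apply mul_left_cancel₀ hx
  linarith

/-- Each row of the channel has divergence at most the capacity from one common output law. This
single-letter bound is uniform in the input, which is what makes feedback harmless later. -/
lemma exists_capacity_center (K : Kernel α β) [IsMarkovKernel K] :
    ∃ q : β → ℝ, (∀ o, 0 ≤ q o) ∧ (Nonempty α → ∑ o, q o = 1) ∧
      (∀ x o, q o = 0 → (K x).real {o} = 0) ∧
      ∀ x, ENNReal.ofReal (∑ o, (K x).real {o} * (Real.log ((K x).real {o}) - Real.log (q o)))
        ≤ capacity K * ENNReal.ofReal (Real.log 2) := by
  classical
  by_cases h : Nonempty α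
  · have hk1 : ∀ x, ∑ o, (K x).real {o} = 1 := fun x => by
      rw [sum_measureReal_singleton]; simp
    obtain ⟨p, hp, h⟩ := exists_finMutualInfo_center (fun x o => (K x).real {o})
      (fun _ _ => measureReal_nonneg) hk1
    refine ⟨fun o => ∑ x', p x' * (K x').real {o},
      fun o => Finset.sum_nonneg fun x _ => mul_nonneg (hp.1 x) measureReal_nonneg, fun _ => ?_,
      fun x => (h x).1, fun x => ?_⟩
    · rw [Finset.sum_comm]
      simp_rw [← Finset.mul_sum, hk1, mul_one]
      exact hp.2
    · exact (ENNReal.ofReal_le_ofReal (h x).2).trans (ofReal_finMutualInfo_le_capacity K hp)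
  -- An empty input alphabet admits no input law, hence no output law; this is why normalisation is
  -- claimed only for nonempty `α`.
  · exact ⟨fun _ => 0, fun _ => le_rfl, fun h' => absurd h' h, fun x => absurd ⟨x⟩ h,
      fun x => absurd ⟨x⟩ h⟩

end CapacityBound

/-! ### Sequences generated step by step from their past -/

section SequentialSums

variable {Y : Type*}

/-- The part before time `t` of the sequence `y`. -/
def past {T : ℕ} (y : Fin T → Y) (t : Fin T) : Fin t → Y := fun s => y (Fin.castLE t.isLt.le s)

/-- The probability of the sequence `y` when `κ t h` is the law of the entry at `t` given the
past `h`. -/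
def chainProb {R : Type*} [CommSemiring R] {T : ℕ} (κ : ∀ t : Fin T, (Fin t → Y) → Y → R)
    (y : Fin T → Y) : R :=
  ∏ t, κ t (past y t) (y t)

lemma past_snoc_castSucc {T : ℕ} (y : Fin T → Y) (o : Y) (t : Fin T) :
    past (Fin.snoc (α := fun _ => Y) y o) t.castSucc = past y t := by
  funext s
  have : Fin.castLE (t.castSucc).isLt.le s = (Fin.castLE t.isLt.le s).castSucc := rfl
  unfold past
  rw [this, Fin.snoc_castSucc]

lemma past_snoc_last {T : ℕ} (y : Fin T → Y) (o : Y) :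
    past (Fin.snoc (α := fun _ => Y) y o) (Fin.last T) = y := by
  funext s
  have : Fin.castLE (Fin.last T).isLt.le s = Fin.castSucc (n := T) s := rfl
  unfold past
  rw [this, Fin.snoc_castSucc]

lemma chainProb_snoc {R : Type*} [CommSemiring R] {T : ℕ}
    (κ : ∀ t : Fin (T + 1), (Fin t → Y) → Y → R) (y : Fin T → Y) (o : Y) :
    chainProb κ (Fin.snoc (α := fun _ => Y) y o)
      = chainProb (fun t : Fin T => κ t.castSucc) y * κ (Fin.last T) y o := by
  unfold chainProb
  rw [Fin.prod_univ_castSucc]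
  simp only [past_snoc_castSucc, past_snoc_last, Fin.snoc_castSucc, Fin.snoc_last]

variable [Fintype Y]

lemma sum_snoc {M : Type*} [AddCommMonoid M] {T : ℕ} (F : (Fin (T + 1) → Y) → M) :
    ∑ y, F y = ∑ y : Fin T → Y, ∑ o : Y, F (Fin.snoc (α := fun _ => Y) y o) := by
  rw [← (Fin.snocEquiv fun _ => Y).sum_comp, Fintype.sum_prod_type, Finset.sum_comm]
  rfl

lemma sum_chainProb {R : Type*} [CommSemiring R] {T : ℕ} (κ : ∀ t : Fin T, (Fin t → Y) → Y → R)
    (hκ : ∀ t h, ∑ o, κ t h o = 1) : ∑ y, chainProb κ y = 1 := by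
  induction T with
  | zero => simp [chainProb]
  | succ T ih =>
    simp only [sum_snoc, chainProb_snoc, ← Finset.mul_sum]
    have h := ih (fun t : Fin T => κ t.castSucc) fun t h => hκ t.castSucc h
    calc _ = ∑ y, chainProb (fun t : Fin T => κ t.castSucc) y :=
          Finset.sum_congr rfl fun y _ => by rw [hκ (Fin.last T) y, mul_one]
      _ = 1 := h

/-- Condition on the past at each time: a bound on every conditional expectation adds up over time,
with no independence between the steps. -/
lemma sum_chainProb_mul_sum_le {T : ℕ} (κ ψ : ∀ t : Fin T, (Fin t → Y) → Y → ℝ) {c : ℝ}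
    (hκ0 : ∀ t h o, 0 ≤ κ t h o) (hκ : ∀ t h, ∑ o, κ t h o = 1)
    (hψ : ∀ t h, ∑ o, κ t h o * ψ t h o ≤ c) :
    ∑ y, chainProb κ y * ∑ t, ψ t (past y t) (y t) ≤ T * c := by
  induction T with
  | zero => simp
  | succ T ih =>
    simp only [sum_snoc, chainProb_snoc, Fin.sum_univ_castSucc, past_snoc_castSucc,
      past_snoc_last, Fin.snoc_castSucc, Fin.snoc_last]
    have h := ih (fun t : Fin T => κ t.castSucc) (fun t : Fin T => ψ t.castSucc)
      (fun t => hκ0 t.castSucc) (fun t h => hκ t.castSucc h) fun t h => hψ t.castSucc h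
    have h1 : ∑ y, chainProb (fun t : Fin T => κ t.castSucc) y = 1 :=
      sum_chainProb _ fun t h => hκ t.castSucc h
    calc _ ≤ ∑ y, (chainProb (fun t : Fin T => κ t.castSucc) y
            * ∑ t : Fin T, ψ t.castSucc (past y t) (y t)
          + chainProb (fun t : Fin T => κ t.castSucc) y * c) := by
          refine Finset.sum_le_sum fun y _ => ?_
          have h0 : 0 ≤ chainProb (fun t : Fin T => κ t.castSucc) y :=
            Finset.prod_nonneg fun t _ => hκ0 _ _ _
          calc _ = chainProb (fun t : Fin T => κ t.castSucc) y
                  * ((∑ o, κ (Fin.last T) y o) * (∑ t : Fin T, ψ t.castSucc (past y t) (y t))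
                    + ∑ o, κ (Fin.last T) y o * ψ (Fin.last T) y o) := by
                rw [Finset.sum_mul, ← Finset.sum_add_distrib, Finset.mul_sum]
                exact Finset.sum_congr rfl fun o _ => by ring
            _ ≤ _ := by
                rw [hκ (Fin.last T) y, one_mul, mul_add]
                have h2 := mul_le_mul_of_nonneg_left (hψ (Fin.last T) y) h0
                linarith
      _ ≤ _ := by
          rw [Finset.sum_add_distrib, ← Finset.sum_mul, h1]
          push_cast
          linarith

end SequentialSums

/-! ### Independent channels at one time -/

section ProductSums

variable {ι : Type*} [Fintype ι] [DecidableEq ι] {O : ι → Type*} [∀ e, Fintype (O e)]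

lemma sum_prod_eq_one {R : Type*} [CommSemiring R] (k : ∀ e, O e → R)
    (hk : ∀ e, ∑ o, k e o = 1) : ∑ y : ∀ e, O e, ∏ e, k e (y e) = 1 := by
  rw [← Fintype.prod_sum]
  simp [hk]

lemma sum_prod_mul_apply (k : ∀ e, O e → ℝ) (hk : ∀ e, ∑ o, k e o = 1) (i : ι) (φ : O i → ℝ) :
    ∑ y : ∀ e, O e, (∏ e, k e (y e)) * φ (y i) = ∑ o, k i o * φ o := by
  -- The weight is absorbed into factor `i`; the sum of products then factorises and the other
  -- factors sum to one.
  have h : ∀ y : ∀ e, O e, (∏ e, k e (y e)) * φ (y i)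
      = ∏ e, Function.update k i (fun o => k i o * φ o) e (y e) := by
    intro y
    rw [← Finset.mul_prod_erase _ _ (Finset.mem_univ i),
      ← Finset.mul_prod_erase (f := fun e => Function.update k i _ e (y e)) _ (Finset.mem_univ i)]
    rw [Function.update_self, mul_right_comm]
    congr 1
    refine Finset.prod_congr rfl fun e he => ?_
    rw [Function.update_of_ne (Finset.ne_of_mem_erase he)]
  simp_rw [h]
  rw [← Fintype.prod_sum, ← Finset.mul_prod_erase _ _ (Finset.mem_univ i),
    Finset.prod_eq_one fun e he => ?_, mul_one, Function.update_self]
  rw [Function.update_of_ne (Finset.ne_of_mem_erase he), hk]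

lemma sum_prod_mul_sum (k φ : ∀ e, O e → ℝ) (hk : ∀ e, ∑ o, k e o = 1) :
    ∑ y : ∀ e, O e, (∏ e, k e (y e)) * ∑ e, φ e (y e) = ∑ e, ∑ o, k e o * φ e o := by
  simp_rw [Finset.mul_sum]
  rw [Finset.sum_comm]
  exact Finset.sum_congr rfl fun i _ => sum_prod_mul_apply k hk i (φ i)

end ProductSums

/-! ### The comparison system and its factorisation along the cut -/

namespace Network

variable {V : Type v} {N : Network.{u} V} {W : V → Type w} [∀ v, MeasurableSpace (W v)]
  {Z : Type z} [MeasurableSpace Z] {T : ℕ}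

/-- The edge `e` leads into `S` from its complement. -/
def IsCut (N : Network.{u} V) (S : Finset V) (e : N.edges) : Prop := e.1.1 ∉ S ∧ e.1.2 ∈ S

instance [DecidableEq V] (S : Finset V) (e : N.edges) : Decidable (N.IsCut S e) :=
  inferInstanceAs (Decidable (_ ∧ _))

namespace Algorithm

variable (A : N.Algorithm W Z T)

/-- The symbol sent over edge `e` at time `t` when `h` are the channel outputs before `t`. -/
def sentPast (x : ∀ v, W v) (t : Fin T) (h : Fin t → N.AllOut) (e : N.edges) : N.In e :=
  A.enc e.1.1 t (x e.1.1, fun s => received e.1.1 (h s)) ⟨e, rfl⟩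

lemma sentPast_past (x : ∀ v, W v) (y : Fin T → N.AllOut) (t : Fin T) (e : N.edges) :
    A.sentPast x t (past y t) e = A.sent x y t e := rfl

lemma measurable_sentPast (t : Fin T) (h : Fin t → N.AllOut) (e : N.edges) :
    Measurable fun x => A.sentPast x t h e :=
  (measurable_pi_apply _).comp
    ((A.measurable_enc e.1.1 t).comp ((measurable_pi_apply _).prodMk measurable_const))

lemma measurable_sent (y : Fin T → N.AllOut) (t : Fin T) (e : N.edges) :
    Measurable fun x => A.sent x y t e :=
  A.measurable_sentPast t (past y t) e

lemma measurable_outputProb (y : Fin T → N.AllOut) : Measurable fun x => A.outputProb x y :=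
  Finset.measurable_prod _ fun t _ => Finset.measurable_prod _ fun e _ =>
    ((N.K e).measurable_coe (measurableSet_singleton _)).comp (A.measurable_sent y t e)

lemma sum_singleton_eq_one (e : N.edges) (i : N.In e) : ∑ o, N.K e i {o} = 1 := by
  rw [sum_measure_singleton]; simp

/-- The output sequences `y` and `y'` coincide on the edges into nodes of `S`. -/
def AgreeOn (S : Finset V) (y y' : Fin T → N.AllOut) : Prop :=
  ∀ t (e : N.edges), e.1.2 ∈ S → y t e = y' t e

lemma estimate_congr {S : Finset V} {v : V} (hv : v ∈ S) {x x' : ∀ v, W v}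
    {y y' : Fin T → N.AllOut} (hx : ∀ v ∈ S, x v = x' v) (hy : AgreeOn S y y') :
    A.estimate v (x, y) = A.estimate v (x', y') := by
  unfold estimate
  congr 1
  simp only
  rw [hx _ hv]
  congr 1
  funext s e'
  exact hy _ _ (by rw [e'.2]; exact hv)

lemma measurable_estimate_left (v : V) (y : Fin T → N.AllOut) :
    Measurable fun x => A.estimate v (x, y) :=
  (A.measurable_est v).comp ((measurable_pi_apply v).prodMk
    (measurable_const (a := fun s => received v (y s))))

lemma measurable_of_measurable_left {β : Type*} [MeasurableSpace β]
    {F : (∀ v, W v) × (Fin T → N.AllOut) → β} (h : ∀ y, Measurable fun x => F (x, y)) :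
    Measurable F :=
  measurable_from_prod_countable_left h

lemma measurable_estimate (v : V) : Measurable (A.estimate v) :=
  measurable_of_measurable_left fun y => A.measurable_estimate_left v y

variable [DecidableEq V]

/-- The law of the outputs of edge `e` in the comparison system, where the channels that enter `S`
are replaced by noise with law `q`. -/
noncomputable def refEdge (S : Finset V) (q : ∀ e, N.Out e → ℝ) (x : ∀ v, W v) (t : Fin T)
    (h : Fin t → N.AllOut) (e : N.edges) (o : N.Out e) : ℝ≥0∞ :=
  if N.IsCut S e then ENNReal.ofReal (q e o) else N.K e (A.sentPast x t h e) {o}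

/-- The probability of the outputs in the comparison system. -/
noncomputable def refProb (S : Finset V) (q : ∀ e, N.Out e → ℝ) (x : ∀ v, W v)
    (y : Fin T → N.AllOut) : ℝ≥0∞ :=
  ∏ t, ∏ e, A.refEdge S q x t (past y t) e (y t e)

/-- The part of `refProb` that belongs to the edges into nodes of `S`. -/
noncomputable def refProbInto (S : Finset V) (q : ∀ e, N.Out e → ℝ) (x : ∀ v, W v)
    (y : Fin T → N.AllOut) : ℝ≥0∞ :=
  ∏ t, ∏ e : N.edges, if e.1.2 ∈ S then A.refEdge S q x t (past y t) e (y t e) else 1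

/-- The part of `refProb` that belongs to the edges into nodes outside of `S`. -/
noncomputable def probOutside (S : Finset V) (x : ∀ v, W v) (y : Fin T → N.AllOut) : ℝ≥0∞ :=
  ∏ t, ∏ e : N.edges, if e.1.2 ∈ S then 1 else N.K e (A.sent x y t e) {y t e}

lemma refProb_eq_mul (S : Finset V) (q : ∀ e, N.Out e → ℝ) (x : ∀ v, W v)
    (y : Fin T → N.AllOut) :
    A.refProb S q x y = A.refProbInto S q x y * A.probOutside S x y := by
  unfold refProb refProbInto probOutside
  simp only [← Finset.prod_mul_distrib]
  refine Finset.prod_congr rfl fun t _ => Finset.prod_congr rfl fun e _ => ?_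
  by_cases he : e.1.2 ∈ S
  · simp [he]
  · simp [he, refEdge, IsCut, sentPast_past]

lemma sum_refEdge {S : Finset V} {q : ∀ e, N.Out e → ℝ} (hq0 : ∀ e o, 0 ≤ q e o)
    (hq : ∀ e, Nonempty (N.In e) → ∑ o, q e o = 1) (x : ∀ v, W v) (t : Fin T)
    (h : Fin t → N.AllOut) (e : N.edges) : ∑ o, A.refEdge S q x t h e o = 1 := by
  unfold refEdge
  split_ifs
  · rw [← ENNReal.ofReal_sum_of_nonneg fun o _ => hq0 e o, hq e ⟨A.sentPast x t h e⟩,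
      ENNReal.ofReal_one]
  · exact sum_singleton_eq_one _ _

-- Replace the channels into `S` by deterministic ones that emit `y`. The result is again a causal
-- system with transition laws of total mass one, and its probability vanishes off the sequences
-- agreeing with `y` on `S`.
open Classical in
lemma sum_agreeOn_probOutside (S : Finset V) (x : ∀ v, W v) (y : Fin T → N.AllOut) :
    ∑ y', (if AgreeOn S y y' then A.probOutside S x y' else 0) = 1 := by
  rw [← sum_chainProb (R := ℝ≥0∞) (T := T) (Y := N.AllOut) (fun t h o => ∏ e : N.edges,
    if e.1.2 ∈ S then (if y t e = o e then 1 else 0) else N.K e (A.sentPast x t h e) {o e}) ?_]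
  · refine Finset.sum_congr rfl fun y' _ => ?_
    unfold chainProb
    split_ifs with h
    · unfold probOutside
      refine Finset.prod_congr rfl fun t _ => Finset.prod_congr rfl fun e _ => ?_
      by_cases he : e.1.2 ∈ S
      · simp [he, h t e he]
      · simp [he, sentPast_past]
    · unfold AgreeOn at h
      push Not at h
      obtain ⟨t, e, he, hne⟩ := h
      symm
      refine Finset.prod_eq_zero (Finset.mem_univ t) (Finset.prod_eq_zero (Finset.mem_univ e) ?_)
      simp [he, hne]
  · intro t h
    refine sum_prod_eq_one (fun (e : N.edges) (o : N.Out e) => if e.1.2 ∈ S then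
      (if y t e = o then (1 : ℝ≥0∞) else 0) else N.K e (A.sentPast x t h e) {o}) fun e => ?_
    by_cases he : e.1.2 ∈ S
    · simp [he]
    · simp [he]

/-- The observations matter for the outputs outside of `S` only through the outputs into `S`. -/
lemma sum_mul_probOutside (S : Finset V) (x x' : ∀ v, W v) (G : (Fin T → N.AllOut) → ℝ≥0∞)
    (hG : ∀ y y', AgreeOn S y y' → G y = G y') :
    ∑ y, G y * A.probOutside S x y = ∑ y, G y * A.probOutside S x' y := by
  classical
  have hsymm : ∀ y y' : Fin T → N.AllOut, AgreeOn S y y' ↔ AgreeOn S y' y := fun y y' =>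
    ⟨fun h t e he => (h t e he).symm, fun h t e he => (h t e he).symm⟩
  -- Inserting a factor one as a sum over sequences that agree with `y` on `S` makes the expression
  -- symmetric in `(x, y)` and `(x', y')`, because `G` takes the same value at both; the other
  -- factor is then summed out.
  calc _ = ∑ y, ∑ y', G y * A.probOutside S x y *
        (if AgreeOn S y y' then A.probOutside S x' y' else 0) := by
        refine Finset.sum_congr rfl fun y _ => ?_
        rw [← Finset.mul_sum, sum_agreeOn_probOutside, mul_one]
    _ = ∑ y', ∑ y, G y' * A.probOutside S x' y' *
        (if AgreeOn S y' y then A.probOutside S x y else 0) := by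
        rw [Finset.sum_comm]
        refine Finset.sum_congr rfl fun y' _ => Finset.sum_congr rfl fun y _ => ?_
        by_cases h : AgreeOn S y y'
        · rw [if_pos h, if_pos ((hsymm _ _).1 h), hG y y' h]
          ring
        · rw [if_neg h, if_neg (mt (hsymm _ _).2 h)]
          simp
    _ = _ := by
        refine Finset.sum_congr rfl fun y _ => ?_
        rw [← Finset.mul_sum, sum_agreeOn_probOutside, mul_one]

/-- Edges into `S` use the observations `x`, all others use `x'`. Such a hybrid is still a causal
system, so its probabilities sum to one even for unrelated `x` and `x'`. -/
lemma sum_refProbInto_mul_probOutside {S : Finset V} {q : ∀ e, N.Out e → ℝ}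
    (hq0 : ∀ e o, 0 ≤ q e o) (hq : ∀ e, Nonempty (N.In e) → ∑ o, q e o = 1) (x x' : ∀ v, W v) :
    ∑ y, A.refProbInto S q x y * A.probOutside S x' y = 1 := by
  rw [← sum_chainProb (R := ℝ≥0∞) (T := T) (Y := N.AllOut) (fun t h o => ∏ e : N.edges,
    if e.1.2 ∈ S then A.refEdge S q x t h e (o e) else N.K e (A.sentPast x' t h e) {o e}) ?_]
  · refine Finset.sum_congr rfl fun y _ => ?_
    unfold chainProb refProbInto probOutside
    simp only [← Finset.prod_mul_distrib]
    refine Finset.prod_congr rfl fun t _ => Finset.prod_congr rfl fun e _ => ?_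
    by_cases he : e.1.2 ∈ S
    · simp [he]
    · simp [he, sentPast_past]
  · intro t h
    refine sum_prod_eq_one (fun (e : N.edges) (o : N.Out e) => if e.1.2 ∈ S then
      A.refEdge S q x t h e o else N.K e (A.sentPast x' t h e) {o}) fun e => ?_
    by_cases he : e.1.2 ∈ S
    · simpa [he] using A.sum_refEdge hq0 hq x t h e
    · simp [he]

lemma sum_outputProb (x : ∀ v, W v) : ∑ y, A.outputProb x y = 1 := by
  rw [← sum_chainProb (R := ℝ≥0∞) (T := T) (Y := N.AllOut) (fun t h o => ∏ e : N.edges,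
    N.K e (A.sentPast x t h e) {o e}) ?_]
  · rfl
  · exact fun t h => sum_prod_eq_one (fun (e : N.edges) (o : N.Out e) =>
      N.K e (A.sentPast x t h e) {o}) fun e => sum_singleton_eq_one e _

/-- An edge into `S` either starts in `S`, so that its input is computed from data available in `S`,
or is a cut edge and carries noise that ignores its input. -/
lemma refProbInto_congr {S : Finset V} (q : ∀ e, N.Out e → ℝ) {x x' : ∀ v, W v}
    {y y' : Fin T → N.AllOut} (hx : ∀ v ∈ S, x v = x' v) (hy : AgreeOn S y y') :
    A.refProbInto S q x y = A.refProbInto S q x' y' := by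
  unfold refProbInto
  refine Finset.prod_congr rfl fun t _ => Finset.prod_congr rfl fun e _ => ?_
  split_ifs with he
  · unfold refEdge
    split_ifs with hc
    · rw [hy t e he]
    · have h1 : e.1.1 ∈ S := by
        by_contra h
        exact hc ⟨h, he⟩
      rw [hy t e he]
      congr 2
      unfold sentPast
      congr 2
      rw [hx _ h1]
      funext s e'
      exact hy _ _ (by rw [e'.2]; exact h1)
  · rfl

lemma measurable_refProbInto (S : Finset V) (q : ∀ e, N.Out e → ℝ) (y : Fin T → N.AllOut) :
    Measurable fun x => A.refProbInto S q x y := by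
  refine Finset.measurable_prod _ fun t _ => Finset.measurable_prod _ fun e _ => ?_
  unfold refEdge
  split_ifs
  · exact measurable_const
  · exact ((N.K e).measurable_coe (measurableSet_singleton _)).comp (A.measurable_sentPast _ _ e)
  · exact measurable_const

lemma lintegral_jointLaw (P : Measure (∀ v, W v)) {F : (∀ v, W v) × (Fin T → N.AllOut) → ℝ≥0∞}
    (hF : ∀ y, Measurable fun x => F (x, y)) :
    ∫⁻ ω, F ω ∂(A.jointLaw P) = ∑ y, ∫⁻ x, A.outputProb x y * F (x, y) ∂P := by
  unfold jointLaw
  rw [lintegral_finsetSum_measure]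
  refine Finset.sum_congr rfl fun y _ => ?_
  rw [lintegral_map (measurable_of_measurable_left hF) measurable_prodMk_right,
    lintegral_withDensity_eq_lintegral_mul _ (A.measurable_outputProb y) (hF y)]
  rfl

instance isProbabilityMeasure_jointLaw (P : Measure (∀ v, W v)) [IsProbabilityMeasure P] :
    IsProbabilityMeasure (A.jointLaw P) := by
  constructor
  rw [← lintegral_one, A.lintegral_jointLaw P (F := fun _ => 1) fun _ => measurable_const,
    ← lintegral_finsetSum _ fun y _ => by simpa using A.measurable_outputProb y]
  simp [sum_outputProb]

lemma map_fst_jointLaw (P : Measure (∀ v, W v)) : (A.jointLaw P).map Prod.fst = P := by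
  ext s hs
  rw [← lintegral_indicator_one hs, ← lintegral_indicator_one hs,
    lintegral_map (measurable_one.indicator hs) measurable_fst,
    A.lintegral_jointLaw P (F := fun ω => s.indicator 1 ω.1) fun _ => measurable_one.indicator hs,
    ← lintegral_finsetSum _ fun y _ => by
      exact (A.measurable_outputProb y).mul (measurable_one.indicator hs)]
  simp only [← Finset.sum_mul, sum_outputProb, one_mul]

lemma map_comp_fst_jointLaw (P : Measure (∀ v, W v)) {β : Type*} [MeasurableSpace β]
    {g : (∀ v, W v) → β} (hg : Measurable g) :
    (A.jointLaw P).map (fun ω => g ω.1) = P.map g := by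
  nth_rw 2 [← A.map_fst_jointLaw P]
  rw [Measure.map_map hg measurable_fst]
  rfl

end Algorithm

end Network

/-! ### Extending observations in `S` to all nodes -/

section Extend

variable {V : Type*} [DecidableEq V] {W : V → Type*}

/-- The observations that agree with `u` in `S` and with `x` outside of `S`. -/
def glue {S : Finset V} (x : ∀ v, W v) (u : ∀ v : S, W v) : ∀ v, W v :=
  fun v => if h : v ∈ S then u ⟨v, h⟩ else x v

lemma measurable_glue [∀ v, MeasurableSpace (W v)] {S : Finset V} (x : ∀ v, W v) :
    Measurable (glue (S := S) x) := by
  refine measurable_pi_lambda _ fun v => ?_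
  unfold glue
  split_ifs with h
  · exact measurable_pi_apply _
  · exact measurable_const

lemma glue_restrict {S : Finset V} (x x' : ∀ v, W v) :
    ∀ v ∈ S, x' v = glue x (S.restrict x') v := fun v hv => by
  simp [glue, hv]

end Extend

/-! ### The log-likelihood ratio and the change of measure -/

namespace Network

variable {V : Type v} {N : Network.{u} V} {W : V → Type w} [∀ v, MeasurableSpace (W v)]
  {Z : Type z} [MeasurableSpace Z] {T : ℕ} [DecidableEq V]

/-- The log-likelihood ratio (in nats) of the output `o` of the channel on edge `e` against the
noise `q` that replaces this channel if it enters `S`. -/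
noncomputable def edgeLLR (N : Network.{u} V) (S : Finset V) (q : ∀ e, N.Out e → ℝ) (e : N.edges)
    (i : N.In e) (o : N.Out e) : ℝ :=
  if N.IsCut S e then Real.log ((N.K e i).real {o}) - Real.log (q e o) else 0

namespace Algorithm

variable (A : N.Algorithm W Z T)

/-- The log-likelihood ratio (in nats) of the system against the comparison system. -/
noncomputable def cutLLR (S : Finset V) (q : ∀ e, N.Out e → ℝ)
    (ω : (∀ v, W v) × (Fin T → N.AllOut)) : ℝ :=
  ∑ t, ∑ e, N.edgeLLR S q e (A.sent ω.1 ω.2 t e) (ω.2 t e)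

/-- The exponential turns each factor of a cut edge from the channel law into the noise law. This is
an equality where the output probability is positive; elsewhere the left side is zero while the
comparison system may still charge the sequence. -/
lemma outputProb_mul_exp_le {S : Finset V} {q : ∀ e, N.Out e → ℝ} (hq0 : ∀ e o, 0 ≤ q e o)
    (hac : ∀ e i o, q e o = 0 → (N.K e i).real {o} = 0) (x : ∀ v, W v) (y : Fin T → N.AllOut) :
    A.outputProb x y * ENNReal.ofReal (Real.exp (-A.cutLLR S q (x, y))) ≤ A.refProb S q x y := by
  by_cases h0 : A.outputProb x y = 0
  · simp [h0]
  have hne : ∀ t e, (N.K e (A.sent x y t e)).real {y t e} ≠ 0 := by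
    intro t e h
    refine h0 (Finset.prod_eq_zero (Finset.mem_univ t) (Finset.prod_eq_zero (Finset.mem_univ e) ?_))
    rwa [measureReal_eq_zero_iff] at h
  refine le_of_eq ?_
  unfold cutLLR outputProb refProb
  simp only [← Finset.sum_neg_distrib, Real.exp_sum]
  rw [ENNReal.ofReal_prod_of_nonneg fun t _ => Finset.prod_nonneg fun e _ => (Real.exp_pos _).le,
    ← Finset.prod_mul_distrib]
  refine Finset.prod_congr rfl fun t _ => ?_
  rw [ENNReal.ofReal_prod_of_nonneg fun e _ => (Real.exp_pos _).le, ← Finset.prod_mul_distrib]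
  refine Finset.prod_congr rfl fun e _ => ?_
  unfold edgeLLR refEdge
  rw [sentPast_past]
  split_ifs with hc
  · have hk : 0 < (N.K e (A.sent x y t e)).real {y t e} :=
      measureReal_nonneg.lt_of_ne (hne t e).symm
    have hqe : 0 < q e (y t e) := (hq0 e _).lt_of_ne fun h => hne t e (hac e _ _ h.symm)
    rw [neg_sub, Real.exp_sub, Real.exp_log hk, Real.exp_log hqe,
      ← ENNReal.ofReal_toReal (measure_ne_top (N.K e (A.sent x y t e)) {y t e}),
      ← ENNReal.ofReal_mul ENNReal.toReal_nonneg]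
    congr 1
    change (N.K e (A.sent x y t e)).real {y t e} * _ = _
    field_simp
  · simp

lemma measurable_edgeLLR_sent (S : Finset V) (q : ∀ e, N.Out e → ℝ) (y : Fin T → N.AllOut)
    (t : Fin T) (e : N.edges) :
    Measurable fun x => N.edgeLLR S q e (A.sent x y t e) (y t e) :=
  (Measurable.of_discrete (f := fun i => N.edgeLLR S q e i (y t e))).comp (A.measurable_sent y t e)

lemma integrable_cutLLR (P : Measure (∀ v, W v)) [IsProbabilityMeasure P] (S : Finset V)
    (q : ∀ e, N.Out e → ℝ) : Integrable (A.cutLLR S q) (A.jointLaw P) := by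
  refine integrable_finsetSum _ fun t _ => integrable_finsetSum _ fun e _ => ?_
  refine Integrable.of_bound (C := ∑ i, ∑ o, ‖N.edgeLLR S q e i o‖)
    (measurable_of_measurable_left fun y =>
      A.measurable_edgeLLR_sent S q y t e).aestronglyMeasurable ?_
  refine Filter.Eventually.of_forall fun ω => ?_
  have h1 := Finset.single_le_sum (f := fun o => ‖N.edgeLLR S q e (A.sent ω.1 ω.2 t e) o‖)
    (fun _ _ => norm_nonneg _) (Finset.mem_univ (ω.2 t e))
  have h2 := Finset.single_le_sum (f := fun i => ∑ o, ‖N.edgeLLR S q e i o‖)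
    (fun _ _ => Finset.sum_nonneg fun _ _ => norm_nonneg _) (Finset.mem_univ (A.sent ω.1 ω.2 t e))
  exact h1.trans h2

lemma measurable_cutLLR_left (S : Finset V) (q : ∀ e, N.Out e → ℝ) (y : Fin T → N.AllOut) :
    Measurable fun x => A.cutLLR S q (x, y) :=
  Finset.measurable_sum _ fun t _ => Finset.measurable_sum _ fun e _ =>
    A.measurable_edgeLLR_sent S q y t e

/-- Given the observations and the past outputs, the channel inputs are determined, so `hc` bounds
the conditional expectation of the ratio at each time. -/
lemma sum_outputProb_mul_cutLLR_le {S : Finset V} {q : ∀ e, N.Out e → ℝ} {c : ℝ}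
    (hc : ∀ i : ∀ e, N.In e, ∑ e, ∑ o, (N.K e (i e)).real {o} * N.edgeLLR S q e (i e) o ≤ c)
    (x : ∀ v, W v) :
    ∑ y, (A.outputProb x y).toReal * A.cutLLR S q (x, y) ≤ T * c := by
  have hsum : ∀ e (i : N.In e), ∑ o, (N.K e i).real {o} = 1 := fun e i => by
    rw [sum_measureReal_singleton]; simp
  have h := sum_chainProb_mul_sum_le (T := T) (Y := N.AllOut) (c := c)
    (fun t h o => ∏ e, (N.K e (A.sentPast x t h e)).real {o e})
    (fun t h o => ∑ e, N.edgeLLR S q e (A.sentPast x t h e) (o e))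
    (fun t h o => Finset.prod_nonneg fun e _ => measureReal_nonneg)
    (fun t h => sum_prod_eq_one (fun (e : N.edges) (o : N.Out e) =>
      (N.K e (A.sentPast x t h e)).real {o}) fun e => hsum e _)
    (fun t h => by
      rw [sum_prod_mul_sum (fun (e : N.edges) (o : N.Out e) =>
        (N.K e (A.sentPast x t h e)).real {o})
        (fun e o => N.edgeLLR S q e (A.sentPast x t h e) o) fun e => hsum e _]
      exact hc _)
  refine le_trans (le_of_eq ?_) h
  refine Finset.sum_congr rfl fun y _ => ?_
  unfold outputProb chainProb cutLLR
  simp only [ENNReal.toReal_prod]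
  rfl

lemma integral_cutLLR_le (P : Measure (∀ v, W v)) [IsProbabilityMeasure P] {S : Finset V}
    {q : ∀ e, N.Out e → ℝ} {c : ℝ}
    (hc : ∀ i : ∀ e, N.In e, ∑ e, ∑ o, (N.K e (i e)).real {o} * N.edgeLLR S q e (i e) o ≤ c) :
    ∫ ω, A.cutLLR S q ω ∂(A.jointLaw P) ≤ T * c := by
  have hint := A.integrable_cutLLR P S q
  have hm : Measurable (A.cutLLR S q) :=
    measurable_of_measurable_left fun y => A.measurable_cutLLR_left S q y
  have hle1 : ∀ x y, A.outputProb x y ≤ 1 := fun x y =>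
    A.sum_outputProb x ▸ Finset.single_le_sum (fun _ _ => zero_le) (Finset.mem_univ y)
  have hI := hint
  unfold jointLaw at hint ⊢
  rw [integrable_finsetSum_measure] at hint
  rw [integral_finsetSum_measure hint]
  have e1 : ∀ y : Fin T → N.AllOut,
      ∫ ω, A.cutLLR S q ω ∂((P.withDensity fun x => A.outputProb x y).map fun x => (x, y))
        = ∫ x, (A.outputProb x y).toReal * A.cutLLR S q (x, y) ∂P := by
    intro y
    rw [integral_map measurable_prodMk_right.aemeasurable hm.aestronglyMeasurable,
      integral_withDensity_eq_integral_toReal_smul (A.measurable_outputProb y)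
        (Filter.Eventually.of_forall fun x => (hle1 x y).trans_lt ENNReal.one_lt_top)]
    rfl
  have i1 : ∀ y : Fin T → N.AllOut,
      Integrable (fun x => (A.outputProb x y).toReal * A.cutLLR S q (x, y)) P := by
    intro y
    have := hint y (Finset.mem_univ y)
    rw [integrable_map_measure hm.aestronglyMeasurable measurable_prodMk_right.aemeasurable,
      integrable_withDensity_iff_integrable_smul' (A.measurable_outputProb y)
        (Filter.Eventually.of_forall fun x => (hle1 x y).trans_lt ENNReal.one_lt_top)] at this
    exact this
  simp only [e1]
  rw [← integral_finsetSum _ fun y _ => i1 y]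
  calc _ ≤ ∫ _, (T * c : ℝ) ∂P := by
        refine integral_mono (integrable_finsetSum _ fun y _ => i1 y) (integrable_const _) fun x => ?_
        exact A.sum_outputProb_mul_cutLLR_le hc x
    _ = T * c := by simp

/-- The change of measure to the comparison system, in which the estimate of a node of `S` depends
on the observations outside of `S` only through the noise. -/
lemma lintegral_mul_exp_neg_cutLLR_le_one (P : Measure (∀ v, W v)) [IsProbabilityMeasure P]
    {S : Finset V} {v : V} (hv : v ∈ S) {q : ∀ e, N.Out e → ℝ} (hq0 : ∀ e o, 0 ≤ q e o)
    (hq : ∀ e, Nonempty (N.In e) → ∑ o, q e o = 1)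
    (hac : ∀ e i o, q e o = 0 → (N.K e i).real {o} = 0)
    {f : (∀ v, W v) → Z} (hf : Measurable f) (m : Measure Z) [SFinite m]
    {r : Z × (∀ v : S, W v) → ℝ≥0∞} (hr : Measurable r)
    (hPr : P.map (fun x => (f x, S.restrict x)) = (m.prod (P.map S.restrict)).withDensity r)
    {a : Z × Z → ℝ≥0∞} (ha : Measurable a) (ha1 : ∀ z', ∫⁻ z, a (z, z') ∂m ≤ 1) :
    ∫⁻ ω, a (f ω.1, A.estimate v ω) * (r (f ω.1, S.restrict ω.1))⁻¹
      * ENNReal.ofReal (Real.exp (-A.cutLLR S q ω)) ∂(A.jointLaw P) ≤ 1 := by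
  obtain ⟨x₀⟩ : Nonempty (∀ v, W v) := nonempty_of_isProbabilityMeasure P
  have hres : Measurable (S.restrict : (∀ v, W v) → ∀ v : S, W v) := by fun_prop
  have hpair : Measurable fun x : ∀ v, W v => (f x, S.restrict x) := hf.prodMk hres
  have hG : ∀ y, Measurable fun x => a (f x, A.estimate v (x, y)) * (r (f x, S.restrict x))⁻¹ :=
    fun y => (ha.comp (hf.prodMk (A.measurable_estimate_left v y))).mul (hr.comp hpair).inv
  rw [A.lintegral_jointLaw P fun y => (hG y).mul
    (A.measurable_cutLLR_left S q y).neg.exp.ennreal_ofReal]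
  have hO : ∀ y, Measurable fun x => A.probOutside S x y := by
    intro y
    refine Finset.measurable_prod _ fun t _ => Finset.measurable_prod _ fun e _ => ?_
    split_ifs
    · exact measurable_const
    · exact ((N.K e).measurable_coe (measurableSet_singleton _)).comp (A.measurable_sent y t e)
  -- Both factors depend on the observations only through `S`. Filling in the fixed `x₀` outside `S`
  -- makes this explicit as a function of the value of `f` and of the observations in `S`.
  let H : (Fin T → N.AllOut) → Z × (∀ v : S, W v) → ℝ≥0∞ := fun y p =>
    a (p.1, A.estimate v (glue x₀ p.2, y)) * A.refProbInto S q (glue x₀ p.2) y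
  have hext : Measurable fun p : Z × (∀ v : S, W v) => glue x₀ p.2 :=
    (measurable_glue x₀).comp measurable_snd
  have hH : ∀ y, Measurable (H y) := fun y =>
    (ha.comp (measurable_fst.prodMk ((A.measurable_estimate_left v y).comp hext))).mul
      ((A.measurable_refProbInto S q y).comp hext)
  have hagree : ∀ y : Fin T → N.AllOut, AgreeOn S y y := fun y t e _ => rfl
  have hHx : ∀ x y, H y (f x, S.restrict x)
      = a (f x, A.estimate v (x, y)) * A.refProbInto S q x y := by
    intro x y
    simp only [H]
    rw [A.estimate_congr hv (glue_restrict x₀ x) (hagree y),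
      A.refProbInto_congr q (glue_restrict x₀ x) (hagree y)]
  calc _ ≤ ∑ y, ∫⁻ x, H y (f x, S.restrict x) * (r (f x, S.restrict x))⁻¹
        * A.probOutside S x y ∂P := by
        refine Finset.sum_le_sum fun y _ => lintegral_mono fun x => ?_
        dsimp only
        rw [hHx]
        calc _ = a (f x, A.estimate v (x, y)) * (r (f x, S.restrict x))⁻¹
              * (A.outputProb x y * ENNReal.ofReal (Real.exp (-A.cutLLR S q (x, y)))) := by ring
          _ ≤ a (f x, A.estimate v (x, y)) * (r (f x, S.restrict x))⁻¹ * A.refProb S q x y :=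
              mul_le_mul_right (A.outputProb_mul_exp_le hq0 hac x y) _
          _ = _ := by rw [refProb_eq_mul]; ring
    _ = ∫⁻ x, ∑ y, H y (f x, S.restrict x) * (r (f x, S.restrict x))⁻¹
        * A.probOutside S x y ∂P := by
        rw [lintegral_finsetSum]
        exact fun y _ => (((hH y).comp hpair).mul (hr.comp hpair).inv).mul (hO y)
    -- The decisive step: for fixed `x` the rest of the summand sees `y` only through the outputs
    -- into `S`, so the outside factor may be evaluated at `x₀`. Afterwards `x` enters only through
    -- `f x` and its restriction to `S`.
    _ = ∫⁻ x, ∑ y, H y (f x, S.restrict x) * (r (f x, S.restrict x))⁻¹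
        * A.probOutside S x₀ y ∂P := by
        refine lintegral_congr fun x => A.sum_mul_probOutside S x x₀ _ fun y y' h => ?_
        simp only [H]
        rw [A.estimate_congr hv (fun _ _ => rfl) h, A.refProbInto_congr q (fun _ _ => rfl) h]
    _ = ∑ y, (∫⁻ x, H y (f x, S.restrict x) * (r (f x, S.restrict x))⁻¹ ∂P)
        * A.probOutside S x₀ y := by
        rw [lintegral_finsetSum]
        · refine Finset.sum_congr rfl fun y _ => ?_
          rw [lintegral_mul_const]
          exact ((hH y).comp hpair).mul (hr.comp hpair).inv
        · exact fun y _ => (((hH y).comp hpair).mul (hr.comp hpair).inv).mul_const _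
    -- Under the law with density `r` the factor `r⁻¹` cancels, leaving `m` times the law of the
    -- observations in `S`. Then `z` occurs only in `a` and is integrated out at cost at most one.
    _ ≤ ∑ y, (∫⁻ u, A.refProbInto S q (glue x₀ u) y ∂(P.map S.restrict))
        * A.probOutside S x₀ y := by
        refine Finset.sum_le_sum fun y _ => mul_le_mul_left ?_ _
        calc _ = ∫⁻ p, H y p * (r p)⁻¹ ∂(P.map fun x => (f x, S.restrict x)) :=
              (lintegral_map ((hH y).mul hr.inv) hpair).symm
          _ = ∫⁻ p, r p * (H y p * (r p)⁻¹) ∂(m.prod (P.map S.restrict)) := by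
              rw [hPr]
              exact lintegral_withDensity_eq_lintegral_mul _ hr ((hH y).mul hr.inv)
          _ ≤ ∫⁻ p, H y p ∂(m.prod (P.map S.restrict)) := by
              refine lintegral_mono fun p => ?_
              calc _ = H y p * (r p * (r p)⁻¹) := by ring
                _ ≤ H y p * 1 := mul_le_mul_right (ENNReal.mul_inv_le_one _) _
                _ = H y p := mul_one _
          _ = ∫⁻ u, ∫⁻ z, H y (z, u) ∂m ∂(P.map S.restrict) :=
              lintegral_prod_symm _ (hH y).aemeasurable
          _ ≤ _ := by
              refine lintegral_mono fun u => ?_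
              simp only [H]
              rw [lintegral_mul_const _ (by exact ha.comp measurable_prodMk_right)]
              exact mul_le_of_le_one_left' (ha1 _)
    _ = ∫⁻ u, ∑ y, A.refProbInto S q (glue x₀ u) y * A.probOutside S x₀ y
        ∂(P.map S.restrict) := by
        rw [lintegral_finsetSum]
        · refine Finset.sum_congr rfl fun y _ => ?_
          rw [lintegral_mul_const]
          exact (A.measurable_refProbInto S q y).comp (measurable_glue x₀)
        · exact fun y _ =>
            ((A.measurable_refProbInto S q y).comp (measurable_glue x₀)).mul_const _
    _ = 1 := by
        have := Measure.isProbabilityMeasure_map (μ := P) hres.aemeasurable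
        simp only [A.sum_refProbInto_mul_probOutside hq0 hq, lintegral_one, measure_univ]

end Algorithm

end Network

/-! ### From exponential moments to expectations -/

section Gibbs

variable {Ω : Type*} [MeasurableSpace Ω] {μ : Measure Ω} {L : Ω → ℝ}

lemma lintegral_ofReal_le_one_of_exp (hL : ∫⁻ ω, ENNReal.ofReal (Real.exp (L ω)) ∂μ ≤ 1) :
    ∫⁻ ω, ENNReal.ofReal (L ω) ∂μ ≤ 1 := by
  refine (lintegral_mono fun ω => ENNReal.ofReal_le_ofReal ?_).trans hL
  linarith [Real.add_one_le_exp (L ω)]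

lemma integral_nonpos_of_lintegral_exp_le_one [IsProbabilityMeasure μ] (hint : Integrable L μ)
    (hL : ∫⁻ ω, ENNReal.ofReal (Real.exp (L ω)) ∂μ ≤ 1) : ∫ ω, L ω ∂μ ≤ 0 := by
  have hm : AEStronglyMeasurable (fun ω => Real.exp (L ω)) μ :=
    Real.continuous_exp.comp_aestronglyMeasurable hint.1
  have h0 : ∀ ω, 0 ≤ Real.exp (L ω) := fun ω => (Real.exp_pos _).le
  have hi : Integrable (fun ω => Real.exp (L ω)) μ :=
    (lintegral_ofReal_ne_top_iff_integrable hm (Filter.Eventually.of_forall h0)).1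
      (hL.trans_lt ENNReal.one_lt_top).ne
  have h1 : ∫ ω, Real.exp (L ω) ∂μ ≤ 1 := by
    rw [integral_eq_lintegral_of_nonneg_ae (Filter.Eventually.of_forall h0) hm]
    exact ENNReal.toReal_le_of_le_ofReal zero_le_one (by simpa using hL)
  calc ∫ ω, L ω ∂μ ≤ ∫ ω, (Real.exp (L ω) - 1) ∂μ :=
        integral_mono hint (hi.sub (integrable_const _)) fun ω => by
          have := Real.add_one_le_exp (L ω)
          dsimp only
          linarith
    _ = ∫ ω, Real.exp (L ω) ∂μ - 1 := by
        rw [integral_sub hi (integrable_const _)]; simp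
    _ ≤ 0 := by linarith

/-- The positive part of `g` is at most that of `g - b` plus `|b|`. This serves when an exponential
moment controls `g - b` only from above. -/
lemma integrable_of_lintegral_ofReal_sub {g b : Ω → ℝ} (hg : AEStronglyMeasurable g μ)
    (hb : Integrable b μ) (h1 : ∫⁻ ω, ENNReal.ofReal (g ω - b ω) ∂μ ≠ ∞)
    (h2 : ∫⁻ ω, ENNReal.ofReal (-g ω) ∂μ ≠ ∞) : Integrable g μ := by
  refine ⟨hg, ?_⟩
  calc ∫⁻ ω, ‖g ω‖ₑ ∂μ ≤ ∫⁻ ω, ((ENNReal.ofReal (g ω - b ω) + ‖b ω‖ₑ)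
        + ENNReal.ofReal (-g ω)) ∂μ := by
        refine lintegral_mono fun ω => ?_
        dsimp only
        rw [← ofReal_norm, ← ofReal_norm]
        rcases le_total 0 (g ω) with h | h
        · rw [Real.norm_of_nonneg h]
          refine le_trans ?_ le_self_add
          refine le_trans (ENNReal.ofReal_le_ofReal ?_) ENNReal.ofReal_add_le
          linarith [Real.le_norm_self (b ω)]
        · rw [Real.norm_of_nonpos h]
          exact le_add_self
    _ = ∫⁻ ω, ENNReal.ofReal (g ω - b ω) ∂μ + ∫⁻ ω, ‖b ω‖ₑ ∂μ
        + ∫⁻ ω, ENNReal.ofReal (-g ω) ∂μ := by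
        rw [lintegral_add_right' _ (by exact hg.aemeasurable.neg.ennreal_ofReal),
          lintegral_add_right' _ hb.1.enorm]
    _ < ∞ := ENNReal.add_lt_top.2 ⟨ENNReal.add_lt_top.2 ⟨h1.lt_top, hb.2⟩, h2.lt_top⟩

end Gibbs

/-! ### Densities and their sections -/

section Density

variable {α β : Type*} [MeasurableSpace α] [MeasurableSpace β]

lemma ae_ne_zero_and_lt_top_of_eq_withDensity {μ ν : Measure α} [IsFiniteMeasure μ] {r : α → ℝ≥0∞}
    (hr : Measurable r) (h : μ = ν.withDensity r) : ∀ᵐ x ∂μ, r x ≠ 0 ∧ r x < ∞ := by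
  have h1 : ∀ᵐ x ∂ν, r x < ∞ := by
    refine ae_lt_top hr ?_
    have : ∫⁻ x, r x ∂ν = μ Set.univ := by rw [h]; simp
    rw [this]
    exact measure_ne_top _ _
  have hac : μ ≪ ν := h ▸ withDensity_absolutelyContinuous _ _
  refine Filter.Eventually.and ?_ (hac.ae_le h1)
  rw [h, ae_withDensity_iff hr]
  exact Filter.Eventually.of_forall fun x hx => hx

/-- A density with respect to the product of the marginals can be chosen so that all its sections
are subprobability densities. -/
lemma exists_density_lintegral_le_one (μ : Measure (α × β)) [IsProbabilityMeasure μ] :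
    ∃ a : α × β → ℝ≥0∞, Measurable a ∧ (∀ b, ∫⁻ x, a (x, b) ∂μ.fst ≤ 1) ∧
      a =ᵐ[μ] μ.rnDeriv (μ.fst.prod μ.snd) := by
  set a₀ := μ.rnDeriv (μ.fst.prod μ.snd) with ha₀
  have hm : Measurable a₀ := Measure.measurable_rnDeriv _ _
  have hmg : Measurable fun b => ∫⁻ x, a₀ (x, b) ∂μ.fst := hm.lintegral_prod_left'
  have hle : ∀ᵐ b ∂μ.snd, ∫⁻ x, a₀ (x, b) ∂μ.fst ≤ 1 := by
    refine ae_le_of_forall_setLIntegral_le_of_sigmaFinite hmg fun s hs _ => ?_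
    calc ∫⁻ b in s, ∫⁻ x, a₀ (x, b) ∂μ.fst ∂μ.snd
        = ∫⁻ p in Set.univ ×ˢ s, a₀ p ∂(μ.fst.prod μ.snd) := by
          rw [← Measure.prod_restrict, Measure.restrict_univ,
            lintegral_prod_symm _ hm.aemeasurable]
      _ ≤ μ (Set.univ ×ˢ s) := Measure.setLIntegral_rnDeriv_le _
      _ = ∫⁻ _ in s, 1 ∂μ.snd := by
          rw [setLIntegral_one, Measure.snd_apply hs, Set.univ_prod]
  set B : Set β := {b | ∫⁻ x, a₀ (x, b) ∂μ.fst ≤ 1} with hB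
  have hBm : MeasurableSet B := measurableSet_le hmg measurable_const
  -- Sections of mass above one are set to zero. The bound is needed for every `b`, since the
  -- comparison system may give the estimate a law that charges null sets of `μ.snd`.
  refine ⟨(Prod.snd ⁻¹' B).indicator a₀, hm.indicator (measurable_snd hBm), fun b => ?_, ?_⟩
  · by_cases hb : b ∈ B
    · simp only [Set.indicator, Set.mem_preimage, hb, if_true]
      exact hb
    · simp [Set.indicator, hb]
  · have : ∀ᵐ p ∂μ, p.2 ∈ B := ae_of_ae_map measurable_snd.aemeasurable hle
    filter_upwards [this] with p hp
    exact Set.indicator_of_mem (s := Prod.snd ⁻¹' B) hp _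

end Density

/-! ### The information bound across a cut -/

namespace Network

variable {V : Type v} {N : Network.{u} V} {W : V → Type w} [∀ v, MeasurableSpace (W v)]
  {Z : Type z} [MeasurableSpace Z] {T : ℕ} [DecidableEq V]

/-- Noise on the edges into `S` from which the channels that enter `S` differ by at most the cutset
capacity. -/
lemma exists_cut_noise (N : Network.{u} V) {S : Finset V} (hS : N.cutCapacity S ≠ ∞) :
    ∃ q : ∀ e, N.Out e → ℝ, (∀ e o, 0 ≤ q e o) ∧ (∀ e, Nonempty (N.In e) → ∑ o, q e o = 1) ∧
      (∀ e i o, q e o = 0 → (N.K e i).real {o} = 0) ∧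
      ∀ i : ∀ e, N.In e, ∑ e, ∑ o, (N.K e (i e)).real {o} * N.edgeLLR S q e (i e) o
        ≤ (N.cutCapacity S).toReal * Real.log 2 := by
  choose q hq0 hq1 hac hq using fun e => exists_capacity_center (N.K e)
  refine ⟨q, hq0, hq1, hac, fun i => ?_⟩
  have htop : ∀ e ∈ Finset.univ, (if e.1.1 ∉ S ∧ e.1.2 ∈ S then capacity (N.K e) else 0) ≠ ∞ :=
    ENNReal.sum_ne_top.1 hS
  unfold cutCapacity
  rw [ENNReal.toReal_sum htop, Finset.sum_mul]
  refine Finset.sum_le_sum fun e he => ?_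
  have h1 := htop e he
  have hdec : ∀ o, N.edgeLLR S q e (i e) o = if e.1.1 ∉ S ∧ e.1.2 ∈ S then
      Real.log ((N.K e (i e)).real {o}) - Real.log (q e o) else 0 := fun o => by
    by_cases h : N.IsCut S e
    · rw [edgeLLR, if_pos h, if_pos (by exact h)]
    · rw [edgeLLR, if_neg h, if_neg (by exact h)]
  simp only [hdec]
  by_cases hc : e.1.1 ∉ S ∧ e.1.2 ∈ S
  · simp only [if_pos hc] at h1 ⊢
    have h2 := hq e (i e)
    rw [← ENNReal.ofReal_toReal h1, ← ENNReal.ofReal_mul ENNReal.toReal_nonneg] at h2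
    exact (ENNReal.ofReal_le_ofReal_iff
      (mul_nonneg ENNReal.toReal_nonneg (Real.log_pos one_lt_two).le)).1 h2
  · simp [if_neg hc]

namespace Algorithm

variable (A : N.Algorithm W Z T)

lemma ae_jointLaw_of_ae {P : Measure (∀ v, W v)} {p : (∀ v, W v) → Prop} (h : ∀ᵐ x ∂P, p x) :
    ∀ᵐ ω ∂(A.jointLaw P), p ω.1 := by
  rw [← A.map_fst_jointLaw P] at h
  exact ae_of_ae_map measurable_fst.aemeasurable h

lemma lintegral_exp_sub_cutLLR_le_one (P : Measure (∀ v, W v)) [IsProbabilityMeasure P]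
    {S : Finset V} {v : V} (hv : v ∈ S) {q : ∀ e, N.Out e → ℝ} (hq0 : ∀ e o, 0 ≤ q e o)
    (hq : ∀ e, Nonempty (N.In e) → ∑ o, q e o = 1)
    (hac : ∀ e i o, q e o = 0 → (N.K e i).real {o} = 0)
    {f : (∀ v, W v) → Z} (hf : Measurable f) (m : Measure Z) [SFinite m]
    {r : Z × (∀ v : S, W v) → ℝ≥0∞} (hr : Measurable r)
    (hPr : P.map (fun x => (f x, S.restrict x)) = (m.prod (P.map S.restrict)).withDensity r)
    {a : Z × Z → ℝ≥0∞} (ha : Measurable a) (ha1 : ∀ z', ∫⁻ z, a (z, z') ∂m ≤ 1)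
    (ha0 : ∀ᵐ ω ∂(A.jointLaw P),
      a (f ω.1, A.estimate v ω) ≠ 0 ∧ a (f ω.1, A.estimate v ω) < ∞) :
    ∫⁻ ω, ENNReal.ofReal (Real.exp (Real.log (a (f ω.1, A.estimate v ω)).toReal
      - Real.log (r (f ω.1, S.restrict ω.1)).toReal - A.cutLLR S q ω)) ∂(A.jointLaw P) ≤ 1 := by
  have hpair : Measurable fun x : ∀ v, W v => (f x, S.restrict x) := hf.prodMk (by fun_prop)
  have hr0 := A.ae_jointLaw_of_ae (ae_of_ae_map hpair.aemeasurable
    (have := Measure.isProbabilityMeasure_map (μ := P) hpair.aemeasurable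
     ae_ne_zero_and_lt_top_of_eq_withDensity hr hPr))
  refine le_trans (le_of_eq (lintegral_congr_ae ?_))
    (A.lintegral_mul_exp_neg_cutLLR_le_one P hv hq0 hq hac hf m hr hPr ha ha1)
  filter_upwards [ha0, hr0] with ω h1 h2
  have ha' := ENNReal.toReal_pos h1.1 h1.2.ne
  have hr' := ENNReal.toReal_pos h2.1 h2.2.ne
  rw [sub_eq_add_neg, Real.exp_add, Real.exp_sub, Real.exp_log ha', Real.exp_log hr',
    ENNReal.ofReal_mul (by positivity), ENNReal.ofReal_div_of_pos hr',
    ENNReal.ofReal_toReal h1.2.ne, ENNReal.ofReal_toReal h2.2.ne, div_eq_mul_inv]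

/-- The change of measure also transfers null sets: let `a` be `∞` on a null set of the product. The
bound by one forces `a < ∞` almost surely, because `r` is almost surely finite. -/
lemma absolutelyContinuous_joint_estimate (P : Measure (∀ v, W v)) [IsProbabilityMeasure P]
    {S : Finset V} {v : V} (hv : v ∈ S) (hS : N.cutCapacity S ≠ ∞)
    {f : (∀ v, W v) → Z} (hf : Measurable f)
    (hac : P.map (fun x => (f x, S.restrict x)) ≪ (P.map f).prod (P.map S.restrict)) :
    (A.jointLaw P).map (fun ω => (f ω.1, A.estimate v ω))
      ≪ (P.map f).prod ((A.jointLaw P).map (A.estimate v)) := by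
  obtain ⟨q, hq0, hq1, hqac, -⟩ := N.exists_cut_noise hS
  have hZ : Measurable fun ω : (∀ v, W v) × (Fin T → N.AllOut) => (f ω.1, A.estimate v ω) :=
    (hf.comp measurable_fst).prodMk (A.measurable_estimate v)
  have hres : Measurable (S.restrict : (∀ v, W v) → ∀ v : S, W v) := by fun_prop
  have hpair : Measurable fun x : ∀ v, W v => (f x, S.restrict x) := hf.prodMk hres
  have := Measure.isProbabilityMeasure_map (μ := P) hf.aemeasurable
  have := Measure.isProbabilityMeasure_map (μ := P) hres.aemeasurable
  have := Measure.isProbabilityMeasure_map (μ := P) hpair.aemeasurable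
  have := Measure.isProbabilityMeasure_map (μ := A.jointLaw P)
    (A.measurable_estimate v).aemeasurable
  set r := (P.map (fun x => (f x, S.restrict x))).rnDeriv ((P.map f).prod (P.map S.restrict))
  have hr : Measurable r := Measure.measurable_rnDeriv _ _
  have hPr : P.map (fun x => (f x, S.restrict x))
      = ((P.map f).prod (P.map S.restrict)).withDensity r :=
    (Measure.withDensity_rnDeriv_eq _ _ hac).symm
  refine Measure.AbsolutelyContinuous.mk fun s hs hs0 => ?_
  -- Almost all sections of `s` are null. Restricting to these makes every section integral of `a`
  -- equal to `∞ * 0 = 0` or the integral of zero.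
  set B : Set Z := {z' | (P.map f) ((fun z => (z, z')) ⁻¹' s) = 0} with hB
  have hBm : MeasurableSet B :=
    measurableSet_eq_fun (measurable_measure_prodMk_right hs) measurable_const
  have hB0 : ∀ᵐ z' ∂((A.jointLaw P).map (A.estimate v)), z' ∈ B := by
    rw [Measure.prod_apply_symm hs, lintegral_eq_zero_iff (measurable_measure_prodMk_right hs)]
      at hs0
    exact hs0
  have hB1 : ∀ᵐ ω ∂(A.jointLaw P), A.estimate v ω ∈ B :=
    ae_of_ae_map (A.measurable_estimate v).aemeasurable hB0
  set a : Z × Z → ℝ≥0∞ := (s ∩ Prod.snd ⁻¹' B).indicator fun _ => ∞ with ha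
  have hsB : MeasurableSet (s ∩ Prod.snd ⁻¹' B) := hs.inter (measurable_snd hBm)
  have ham : Measurable a := measurable_const.indicator hsB
  have ha1 : ∀ z', ∫⁻ z, a (z, z') ∂(P.map f) ≤ 1 := by
    intro z'
    have : (fun z => a (z, z')) = ((fun z => (z, z')) ⁻¹' (s ∩ Prod.snd ⁻¹' B)).indicator
        fun _ => ∞ := rfl
    rw [this, lintegral_indicator_const (measurable_prodMk_right hsB)]
    by_cases hz : z' ∈ B
    · have h0 : (P.map f) ((fun z => (z, z')) ⁻¹' (s ∩ Prod.snd ⁻¹' B)) = 0 :=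
        measure_mono_null (fun z hz => hz.1) hz
      rw [h0, mul_zero]
      exact zero_le_one
    · have h0 : (fun z => (z, z')) ⁻¹' (s ∩ Prod.snd ⁻¹' B) = ∅ := by
        ext z
        simp [hz]
      simp [h0]
  have key := A.lintegral_mul_exp_neg_cutLLR_le_one P hv hq0 hq1 hqac hf (P.map f) hr hPr ham ha1
  have hmeas : Measurable fun ω => a (f ω.1, A.estimate v ω) * (r (f ω.1, S.restrict ω.1))⁻¹
      * ENNReal.ofReal (Real.exp (-A.cutLLR S q ω)) :=
    ((ham.comp hZ).mul (hr.comp (hpair.comp measurable_fst)).inv).mul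
      (measurable_of_measurable_left fun y => A.measurable_cutLLR_left S q y).neg.exp.ennreal_ofReal
  have hlt := ae_lt_top hmeas (key.trans_lt ENNReal.one_lt_top).ne
  have hr0 := A.ae_jointLaw_of_ae (ae_of_ae_map hpair.aemeasurable
    (ae_ne_zero_and_lt_top_of_eq_withDensity hr hPr))
  rw [Measure.map_apply hZ hs, ← compl_compl ((fun ω => (f ω.1, A.estimate v ω)) ⁻¹' s),
    ← mem_ae_iff]
  filter_upwards [hlt, hr0, hB1] with ω h1 h2 h3 hmem
  have : a (f ω.1, A.estimate v ω) = ∞ := Set.indicator_of_mem (s := s ∩ Prod.snd ⁻¹' B) ⟨hmem, h3⟩ _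
  rw [this, ENNReal.top_mul (ENNReal.inv_ne_zero.2 h2.2.ne), ENNReal.top_mul
    (by simpa using Real.exp_pos _)] at h1
  exact lt_irrefl _ h1

/-- A data processing inequality with leakage: the estimate knows no more about the computed
quantity than the observations in `S` do, up to what the cut channels deliver in `T` uses. -/
lemma klDiv_joint_estimate_le (P : Measure (∀ v, W v)) [IsProbabilityMeasure P]
    {S : Finset V} {v : V} (hv : v ∈ S) (hS : N.cutCapacity S ≠ ∞)
    {f : (∀ v, W v) → Z} (hf : Measurable f) :
    InformationTheory.klDiv ((A.jointLaw P).map (fun ω => (f ω.1, A.estimate v ω)))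
        ((P.map f).prod ((A.jointLaw P).map (A.estimate v)))
      ≤ InformationTheory.klDiv (P.map (fun x => (f x, S.restrict x)))
          ((P.map f).prod (P.map S.restrict))
        + T * N.cutCapacity S * ENNReal.ofReal (Real.log 2) := by
  have hZ : Measurable fun ω : (∀ v, W v) × (Fin T → N.AllOut) => (f ω.1, A.estimate v ω) :=
    (hf.comp measurable_fst).prodMk (A.measurable_estimate v)
  have hres : Measurable (S.restrict : (∀ v, W v) → ∀ v : S, W v) := by fun_prop
  have hpair : Measurable fun x : ∀ v, W v => (f x, S.restrict x) := hf.prodMk hres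
  have := Measure.isProbabilityMeasure_map (μ := P) hf.aemeasurable
  have := Measure.isProbabilityMeasure_map (μ := P) hres.aemeasurable
  have := Measure.isProbabilityMeasure_map (μ := P) hpair.aemeasurable
  have := Measure.isProbabilityMeasure_map (μ := A.jointLaw P)
    (A.measurable_estimate v).aemeasurable
  have := Measure.isProbabilityMeasure_map (μ := A.jointLaw P) hZ.aemeasurable
  by_cases htop : InformationTheory.klDiv (P.map (fun x => (f x, S.restrict x)))
      ((P.map f).prod (P.map S.restrict)) = ∞
  · simp [htop]
  obtain ⟨hac, hint⟩ := InformationTheory.klDiv_ne_top_iff.1 htop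
  have hac' := A.absolutelyContinuous_joint_estimate P hv hS hf hac
  obtain ⟨q, hq0, hq1, hqac, hqc⟩ := N.exists_cut_noise hS
  set ρ := P.map (fun x => (f x, S.restrict x)) with hρ
  set κ := (P.map f).prod (P.map S.restrict) with hκ
  set μ := (A.jointLaw P).map (fun ω => (f ω.1, A.estimate v ω)) with hμ
  set ν := (P.map f).prod ((A.jointLaw P).map (A.estimate v)) with hν
  have hfst : μ.fst = P.map f :=
    (Measure.fst_map_prodMk (A.measurable_estimate v)).trans (A.map_comp_fst_jointLaw P hf)
  have hsnd : μ.snd = (A.jointLaw P).map (A.estimate v) := by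
    exact Measure.snd_map_prodMk (hf.comp measurable_fst)
  have hνeq : μ.fst.prod μ.snd = ν := by rw [hfst, hsnd]
  obtain ⟨a, ham, ha1, haeq⟩ := exists_density_lintegral_le_one μ
  rw [hνeq] at haeq
  rw [hfst] at ha1
  have hr : Measurable (ρ.rnDeriv κ) := Measure.measurable_rnDeriv _ _
  have hPr : ρ = κ.withDensity (ρ.rnDeriv κ) := (Measure.withDensity_rnDeriv_eq _ _ hac).symm
  have ha0 : ∀ᵐ p ∂μ, a p ≠ 0 ∧ a p < ∞ := by
    have h := ae_ne_zero_and_lt_top_of_eq_withDensity (Measure.measurable_rnDeriv μ ν)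
      (Measure.withDensity_rnDeriv_eq _ _ hac').symm
    filter_upwards [h, haeq] with p h1 h2
    rwa [h2]
  have hL := A.lintegral_exp_sub_cutLLR_le_one P hv hq0 hq1 hqac hf (P.map f) hr hPr ham ha1
    (ae_of_ae_map hZ.aemeasurable ha0)
  have haeq' : ∀ᵐ ω ∂(A.jointLaw P), Real.log (a (f ω.1, A.estimate v ω)).toReal
      = llr μ ν (f ω.1, A.estimate v ω) := by
    filter_upwards [ae_of_ae_map hZ.aemeasurable haeq] with ω h
    rw [h, llr_def]
  set L : (∀ v, W v) × (Fin T → N.AllOut) → ℝ := fun ω => llr μ ν (f ω.1, A.estimate v ω)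
    - llr ρ κ (f ω.1, S.restrict ω.1) - A.cutLLR S q ω with hLdef
  have hL' : ∫⁻ ω, ENNReal.ofReal (Real.exp (L ω)) ∂(A.jointLaw P) ≤ 1 := by
    refine le_trans (le_of_eq (lintegral_congr_ae ?_)) hL
    filter_upwards [haeq'] with ω h
    rw [h]
    rfl
  have hmap : (A.jointLaw P).map (fun ω => (f ω.1, S.restrict ω.1)) = ρ :=
    A.map_comp_fst_jointLaw P hpair
  have hpair' : Measurable fun ω : (∀ v, W v) × (Fin T → N.AllOut) =>
    (f ω.1, S.restrict ω.1) := hpair.comp measurable_fst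
  have hirρ : Integrable (fun ω => llr ρ κ (f ω.1, S.restrict ω.1)) (A.jointLaw P) := by
    rw [← hmap] at hint
    have := hint.comp_measurable hpair'
    rwa [hmap] at this
  have hic := A.integrable_cutLLR P S q
  have hlm : Measurable fun ω : (∀ v, W v) × (Fin T → N.AllOut) =>
    llr μ ν (f ω.1, A.estimate v ω) := (measurable_llr μ ν).comp hZ
  -- The negative part of a log-likelihood ratio is always integrable, since `exp (-llr)` is the
  -- reverse density, of mass at most one. The positive part is controlled by the exponential moment
  -- of `L`.
  have hneg : ∫⁻ ω, ENNReal.ofReal (-llr μ ν (f ω.1, A.estimate v ω)) ∂(A.jointLaw P) ≤ 1 := by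
    refine lintegral_ofReal_le_one_of_exp ?_
    have h1 : ∫⁻ p, ENNReal.ofReal (Real.exp (-llr μ ν p)) ∂μ ≤ 1 := by
      calc _ = ∫⁻ p, ν.rnDeriv μ p ∂μ := by
            refine lintegral_congr_ae ?_
            filter_upwards [exp_neg_llr hac', Measure.rnDeriv_lt_top ν μ] with p h1 h2
            rw [h1, ENNReal.ofReal_toReal h2.ne]
        _ ≤ ν Set.univ := Measure.lintegral_rnDeriv_le
        _ = 1 := measure_univ
    have h2 : Measurable fun p => ENNReal.ofReal (Real.exp (-llr μ ν p)) :=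
      (measurable_llr μ ν).neg.exp.ennreal_ofReal
    exact (lintegral_map h2 hZ).symm.trans_le h1
  have hpos := lintegral_ofReal_le_one_of_exp hL'
  have hiμ : Integrable (fun ω => llr μ ν (f ω.1, A.estimate v ω)) (A.jointLaw P) := by
    refine integrable_of_lintegral_ofReal_sub (b := fun ω => llr ρ κ (f ω.1, S.restrict ω.1)
      + A.cutLLR S q ω) hlm.aestronglyMeasurable (hirρ.add hic) ?_
      (hneg.trans_lt ENNReal.one_lt_top).ne
    simp only [← sub_sub]
    exact (hpos.trans_lt ENNReal.one_lt_top).ne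
  have hle : ∫ ω, L ω ∂(A.jointLaw P) ≤ 0 :=
    integral_nonpos_of_lintegral_exp_le_one ((hiμ.sub hirρ).sub hic) hL'
  have hsplit : ∫ ω, L ω ∂(A.jointLaw P) = ∫ p, llr μ ν p ∂μ - ∫ p, llr ρ κ p ∂ρ
      - ∫ ω, A.cutLLR S q ω ∂(A.jointLaw P) := by
    have e1 : ∫ p, llr μ ν p ∂μ = ∫ ω, llr μ ν (f ω.1, A.estimate v ω) ∂(A.jointLaw P) :=
      integral_map hZ.aemeasurable (measurable_llr μ ν).aestronglyMeasurable
    have e2 : ∫ p, llr ρ κ p ∂ρ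
        = ∫ ω, llr ρ κ (f ω.1, S.restrict ω.1) ∂(A.jointLaw P) := by
      rw [← integral_map hpair'.aemeasurable (measurable_llr ρ κ).aestronglyMeasurable, hmap]
    rw [e1, e2]
    have h1 := integral_sub (hiμ.sub hirρ) hic
    have h2 := integral_sub hiμ hirρ
    rw [← h2]
    exact h1
  have hint' : Integrable (llr μ ν) μ :=
    (integrable_map_measure (measurable_llr μ ν).aestronglyMeasurable hZ.aemeasurable).2 hiμ
  have hcut := A.integral_cutLLR_le P hqc
  rw [InformationTheory.klDiv_of_ac_of_integrable hac hint,
    InformationTheory.klDiv_of_ac_of_integrable hac' hint']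
  simp only [probReal_univ, add_sub_cancel_right]
  have hT : (T : ℝ≥0∞) * N.cutCapacity S * ENNReal.ofReal (Real.log 2)
      = ENNReal.ofReal (T * ((N.cutCapacity S).toReal * Real.log 2)) := by
    rw [ENNReal.ofReal_mul (Nat.cast_nonneg _), ENNReal.ofReal_mul ENNReal.toReal_nonneg,
      ENNReal.ofReal_toReal hS, ENNReal.ofReal_natCast, mul_assoc]
  rw [hT]
  refine le_trans (ENNReal.ofReal_le_ofReal ?_) ENNReal.ofReal_add_le
  rw [hsplit] at hle
  linarith

end Algorithm

end Network

/-! ### Extended real conventions -/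

section ERealLemmas

lemma log2_eq_coe {x : ℝ≥0∞} (h0 : x ≠ 0) (h1 : x ≠ ∞) :
    log2 x = ((Real.log x.toReal / Real.log 2 : ℝ) : EReal) := by
  rw [log2, ENNReal.log_pos_real h0 h1, EReal.coe_div]

/-- An infinite capacity makes the quotient zero, so the bound on `a` is needed only for finite `C`;
for this reason the converse lemmas may assume a finite cutset capacity. -/
lemma perCapacity_le {a : EReal} {C : ℝ≥0∞} {T : ℕ}
    (h : C ≠ ∞ → a ≤ (((T : ℝ≥0∞) * C : ℝ≥0∞) : EReal)) :
    perCapacity a C ≤ ((T : ℝ≥0∞) : EReal) := by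
  unfold perCapacity
  have hT : (0 : EReal) ≤ ((T : ℝ≥0∞) : EReal) := EReal.coe_ennreal_nonneg _
  have hC : (0 : EReal) ≤ ((C⁻¹ : ℝ≥0∞) : EReal) := EReal.coe_ennreal_nonneg _
  by_cases hCt : C = ∞
  · simpa [hCt] using hT
  rcases le_or_gt a 0 with ha | ha
  · exact (EReal.mul_nonpos_iff.2 (Or.inr ⟨ha, hC⟩)).trans hT
  · refine (mul_le_mul_of_nonneg_right (h hCt) hC).trans ?_
    rw [← EReal.coe_ennreal_mul, mul_assoc]
    refine EReal.coe_ennreal_le_coe_ennreal_iff.2 ?_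
    exact (mul_le_mul_right (ENNReal.mul_inv_le_one C) _).trans_eq (mul_one _)

end ERealLemmas

/-! ### The two bounds for one algorithm -/

namespace Network

variable {V : Type v} {N : Network.{u} V} {W : V → Type w} [∀ v, MeasurableSpace (W v)]
  {T : ℕ} [DecidableEq V]

lemma le_Tmax {Z : Type z} [MeasurableSpace Z] {P : Measure (∀ v, W v)} {f : (∀ v, W v) → Z}
    {d : Z → Z → ℝ≥0} {ε : ℝ≥0} {X : EReal}
    (h : ∀ (T : ℕ) (A : N.Algorithm W Z T),
      (∀ v, A.expectedDistortion P f d v ≤ (ε : ℝ≥0∞)) → X ≤ ((T : ℝ≥0∞) : EReal)) :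
    X ≤ ((N.Tmax P f d ε : ℝ≥0∞) : EReal) := by
  by_cases htop : N.Tmax P f d ε = ⊤
  · simp [htop]
  obtain ⟨t, ht⟩ := ENat.ne_top_iff_exists.1 htop
  -- A strict upper bound yields an admissible algorithm from the infimum, and integrality brings
  -- its number of steps back to at most `t`.
  have hlt : N.Tmax P f d ε < ((t + 1 : ℕ) : ℕ∞) := by
    rw [← ht]
    exact_mod_cast Nat.lt_succ_self t
  unfold Tmax at hlt
  simp only [iInf_lt_iff] at hlt
  obtain ⟨T, ⟨A, hA⟩, hT⟩ := hlt
  have hT' : T ≤ t := Nat.lt_succ_iff.1 (by exact_mod_cast hT)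
  refine (h T A hA).trans ?_
  rw [← ht]
  refine EReal.coe_ennreal_le_coe_ennreal_iff.2 ?_
  simpa using hT'

namespace Algorithm

/-- The conditional law of the estimate given the computed quantity is an admissible test channel;
it exists because `Z` is standard Borel. -/
lemma rateDistortion_le {Z : Type z} [MeasurableSpace Z] [StandardBorelSpace Z]
    (A : N.Algorithm W Z T) (P : Measure (∀ v, W v)) [IsProbabilityMeasure P]
    {S : Finset V} {v : V} (hv : v ∈ S) (hS : N.cutCapacity S ≠ ∞)
    {f : (∀ v, W v) → Z} (hf : Measurable f) {d : Z → Z → ℝ≥0}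
    (hd : Measurable (Function.uncurry d)) {ε : ℝ≥0}
    (hε : A.expectedDistortion P f d v ≤ (ε : ℝ≥0∞)) :
    rateDistortion d (P.map f) ε
      ≤ mutualInfo (P.map fun x => (f x, S.restrict x)) + T * N.cutCapacity S := by
  obtain ⟨x₀⟩ : Nonempty (∀ v, W v) := nonempty_of_isProbabilityMeasure P
  have : Nonempty Z := ⟨f x₀⟩
  have hZ : Measurable fun ω : (∀ v, W v) × (Fin T → N.AllOut) => (f ω.1, A.estimate v ω) :=
    (hf.comp measurable_fst).prodMk (A.measurable_estimate v)
  have hres : Measurable (S.restrict : (∀ v, W v) → ∀ v : S, W v) := by fun_prop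
  have := Measure.isProbabilityMeasure_map (μ := A.jointLaw P) hZ.aemeasurable
  set μ := (A.jointLaw P).map (fun ω => (f ω.1, A.estimate v ω)) with hμ
  have hfst : μ.fst = P.map f :=
    (Measure.fst_map_prodMk (A.measurable_estimate v)).trans (A.map_comp_fst_jointLaw P hf)
  have hsnd : μ.snd = (A.jointLaw P).map (A.estimate v) :=
    Measure.snd_map_prodMk (hf.comp measurable_fst)
  have hdis : P.map f ⊗ₘ μ.condKernel = μ := by
    rw [← hfst]
    exact μ.disintegrate μ.condKernel
  have hdist : ∫⁻ p, (d p.1 p.2 : ℝ≥0∞) ∂(P.map f ⊗ₘ μ.condKernel) ≤ (ε : ℝ≥0∞) := by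
    rw [hdis, hμ, lintegral_map (by exact hd.coe_nnreal_ennreal) hZ]
    exact hε
  have hlog2 : ENNReal.ofReal (Real.log 2) ≠ 0 := by
    simpa using Real.log_pos one_lt_two
  calc rateDistortion d (P.map f) ε ≤ mutualInfo (P.map f ⊗ₘ μ.condKernel) :=
        iInf_le_of_le μ.condKernel (iInf₂_le_of_le inferInstance hdist le_rfl)
    _ = InformationTheory.klDiv μ (μ.fst.prod μ.snd) / ENNReal.ofReal (Real.log 2) := by
        rw [hdis, mutualInfo]
    _ ≤ (InformationTheory.klDiv (P.map (fun x => (f x, S.restrict x)))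
          ((P.map f).prod (P.map S.restrict))
        + T * N.cutCapacity S * ENNReal.ofReal (Real.log 2)) / ENNReal.ofReal (Real.log 2) := by
        rw [hfst, hsnd]
        exact ENNReal.div_le_div_right (A.klDiv_joint_estimate_le P hv hS hf) _
    _ = _ := by
        rw [ENNReal.add_div, ENNReal.mul_div_cancel_right hlog2 ENNReal.ofReal_ne_top, mutualInfo,
          Measure.fst_map_prodMk hres, Measure.snd_map_prodMk hf]

/-- The entropy bound of an algorithm with mean square error at most `ε`: the conditional density
of the computed quantity is compared with the Gaussian density of variance `ε` around the
estimate. -/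
lemma condDiffEntropy_le (A : N.Algorithm W ℝ T) (P : Measure (∀ v, W v)) [IsProbabilityMeasure P]
    {S : Finset V} {v : V} (hv : v ∈ S) (hS : N.cutCapacity S ≠ ∞)
    {f : (∀ v, W v) → ℝ} (hf : Measurable f) {ε : ℝ≥0} (hε0 : ε ≠ 0)
    (hε : A.expectedDistortion P f (fun z z' => Real.toNNReal ((z - z') ^ 2)) v ≤ (ε : ℝ≥0∞)) :
    condDiffEntropy (P.map fun x => (f x, S.restrict x))
      ≤ ((T * (N.cutCapacity S).toReal
        + 1 / 2 * (Real.log (2 * Real.pi * Real.exp 1 * ε) / Real.log 2) : ℝ) : EReal) := by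
  have hZ : Measurable fun ω : (∀ v, W v) × (Fin T → N.AllOut) => (f ω.1, A.estimate v ω) :=
    (hf.comp measurable_fst).prodMk (A.measurable_estimate v)
  have hres : Measurable (S.restrict : (∀ v, W v) → ∀ v : S, W v) := by fun_prop
  have hpair : Measurable fun x : ∀ v, W v => (f x, S.restrict x) := hf.prodMk hres
  have hpair' : Measurable fun ω : (∀ v, W v) × (Fin T → N.AllOut) =>
    (f ω.1, S.restrict ω.1) := hpair.comp measurable_fst
  have := Measure.isProbabilityMeasure_map (μ := P) hres.aemeasurable
  have := Measure.isProbabilityMeasure_map (μ := P) hpair.aemeasurable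
  set ρ := P.map (fun x => (f x, S.restrict x)) with hρ
  have hsnd : ρ.snd = P.map S.restrict := Measure.snd_map_prodMk hf
  unfold condDiffEntropy
  split_ifs with hac
  swap
  · exact bot_le
  rw [hsnd] at hac ⊢
  set r := ρ.rnDeriv ((volume : Measure ℝ).prod (P.map S.restrict)) with hrdef
  have hr : Measurable r := Measure.measurable_rnDeriv _ _
  have hPr : ρ = ((volume : Measure ℝ).prod (P.map S.restrict)).withDensity r :=
    (Measure.withDensity_rnDeriv_eq _ _ hac).symm
  have hr0 := ae_ne_zero_and_lt_top_of_eq_withDensity hr hPr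
  have hlog2 : 0 < Real.log 2 := Real.log_pos one_lt_two
  set lr : ℝ × (∀ v : S, W v) → ℝ := fun p => Real.log (r p).toReal with hlr
  have hlrm : Measurable lr := hr.ennreal_toReal.log
  have hX : ∫⁻ p, (-log2 (r p)).toENNReal ∂ρ = ∫⁻ p, ENNReal.ofReal (-(lr p / Real.log 2)) ∂ρ := by
    refine lintegral_congr_ae ?_
    filter_upwards [hr0] with p hp
    rw [log2_eq_coe hp.1 hp.2.ne, ← EReal.coe_neg, EReal.toENNReal_of_ne_top (EReal.coe_ne_top _)]
    rfl
  have hY : ∫⁻ p, (log2 (r p)).toENNReal ∂ρ = ∫⁻ p, ENNReal.ofReal (lr p / Real.log 2) ∂ρ := by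
    refine lintegral_congr_ae ?_
    filter_upwards [hr0] with p hp
    rw [log2_eq_coe hp.1 hp.2.ne, EReal.toENNReal_of_ne_top (EReal.coe_ne_top _)]
    rfl
  rw [hX, hY]
  -- An infinite subtracted part makes the entropy `-∞`. Otherwise its finiteness supplies one half
  -- of the integrability of `lr`, and the exponential moment supplies the other.
  by_cases hYt : ∫⁻ p, ENNReal.ofReal (lr p / Real.log 2) ∂ρ = ∞
  · rw [hYt]
    simp
  obtain ⟨q, hq0, hq1, hqac, hqc⟩ := N.exists_cut_noise hS
  have hmap : (A.jointLaw P).map (fun ω => (f ω.1, S.restrict ω.1)) = ρ :=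
    A.map_comp_fst_jointLaw P hpair
  have hεpos : (0 : ℝ) < ε := NNReal.coe_pos.2 (pos_iff_ne_zero.2 hε0)
  have hgm : Measurable fun p : ℝ × ℝ => gaussianPDF p.2 ε p.1 := by
    unfold gaussianPDF gaussianPDFReal
    fun_prop
  have hL := A.lintegral_exp_sub_cutLLR_le_one P hv hq0 hq1 hqac hf volume hr hPr hgm
    (fun z' => (lintegral_gaussianPDF_eq_one z' hε0).le)
    (Filter.Eventually.of_forall fun ω => ⟨(gaussianPDF_pos _ hε0 _).ne', gaussianPDF_lt_top⟩)
  set D : (∀ v, W v) × (Fin T → N.AllOut) → ℝ := fun ω => (f ω.1 - A.estimate v ω) ^ 2 with hD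
  have hDm : Measurable D := by
    have h1 : Measurable fun ω : (∀ v, W v) × (Fin T → N.AllOut) => f ω.1 :=
      hf.comp measurable_fst
    exact (h1.sub (A.measurable_estimate v)).pow_const 2
  have hDle : ∫⁻ ω, ENNReal.ofReal (D ω) ∂(A.jointLaw P) ≤ (ε : ℝ≥0∞) := hε
  have hDi : Integrable D (A.jointLaw P) :=
    (lintegral_ofReal_ne_top_iff_integrable hDm.aestronglyMeasurable
      (Filter.Eventually.of_forall fun _ => sq_nonneg _)).1
      (hDle.trans_lt ENNReal.coe_lt_top).ne
  have hDint : ∫ ω, D ω ∂(A.jointLaw P) ≤ ε := by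
    rw [integral_eq_lintegral_of_nonneg_ae (Filter.Eventually.of_forall fun _ => sq_nonneg _)
      hDm.aestronglyMeasurable]
    exact ENNReal.toReal_le_of_le_ofReal ε.2 (by simpa using hDle)
  set la : (∀ v, W v) × (Fin T → N.AllOut) → ℝ := fun ω =>
    -(1 / 2 * Real.log (2 * Real.pi * ε)) - D ω / (2 * ε) with hla
  have hlaeq : ∀ ω, Real.log (gaussianPDF (A.estimate v ω) ε (f ω.1)).toReal = la ω := by
    intro ω
    rw [toReal_gaussianPDF, gaussianPDFReal, Real.log_mul (by positivity) (Real.exp_pos _).ne',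
      Real.log_exp, Real.log_inv, Real.log_sqrt (by positivity)]
    simp only [hla, hD]
    ring
  have hlai : Integrable la (A.jointLaw P) := (integrable_const _).sub (hDi.div_const _)
  simp only [hlaeq] at hL
  have hic := A.integrable_cutLLR P S q
  have hlr'm : Measurable fun ω : (∀ v, W v) × (Fin T → N.AllOut) =>
    lr (f ω.1, S.restrict ω.1) := hlrm.comp hpair'
  have hneg : Integrable (fun ω => -lr (f ω.1, S.restrict ω.1)) (A.jointLaw P) := by
    refine integrable_of_lintegral_ofReal_sub (b := fun ω => A.cutLLR S q ω - la ω)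
      hlr'm.neg.aestronglyMeasurable (hic.sub hlai) ?_ ?_
    · have h1 := ((lintegral_ofReal_le_one_of_exp hL).trans_lt ENNReal.one_lt_top).ne
      convert! h1 using 3
      congr 1
      ring
    · simp only [neg_neg]
      rw [← hmap, lintegral_map (hlrm.div_const _).ennreal_ofReal hpair'] at hYt
      intro h
      refine hYt ?_
      have e : ∀ x : ℝ, ENNReal.ofReal (x / Real.log 2)
          = ENNReal.ofReal x * ENNReal.ofReal (Real.log 2)⁻¹ := fun x => by
        rw [div_eq_mul_inv, ENNReal.ofReal_mul' (by positivity)]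
      simp only [e]
      rw [lintegral_mul_const _ hlr'm.ennreal_ofReal, h, ENNReal.top_mul]
      simpa using hlog2
  have hlr'i : Integrable (fun ω => lr (f ω.1, S.restrict ω.1)) (A.jointLaw P) := by
    simpa using hneg.neg
  have hlri : Integrable lr ρ := by
    rw [← hmap]
    exact (integrable_map_measure hlrm.aestronglyMeasurable hpair'.aemeasurable).2 hlr'i
  have hlrint : ∫ p, lr p ∂ρ = ∫ ω, lr (f ω.1, S.restrict ω.1) ∂(A.jointLaw P) := by
    rw [← hmap]
    exact integral_map hpair'.aemeasurable hlrm.aestronglyMeasurable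
  have hle := integral_nonpos_of_lintegral_exp_le_one ((hlai.sub hlr'i).sub hic) hL
  have h1 := integral_sub (hlai.sub hlr'i) hic
  have h2 := integral_sub hlai hlr'i
  -- The quadratic term of the Gaussian costs at most one half nat because the mean square error is
  -- at most `ε`; this is the factor `e` in `2πeε`.
  have hlaint : -(1 / 2 * Real.log (2 * Real.pi * ε)) - 1 / 2 ≤ ∫ ω, la ω ∂(A.jointLaw P) := by
    rw [hla, integral_sub (integrable_const _) (hDi.div_const _), integral_div]
    simp only [integral_const, probReal_univ, one_smul]
    have : (∫ ω, D ω ∂(A.jointLaw P)) / (2 * ε) ≤ 1 / 2 := by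
      rw [div_le_iff₀ (by positivity)]
      linarith
    linarith
  have hcut := A.integral_cutLLR_le P hqc
  have hfinal : -∫ p, lr p ∂ρ ≤ T * ((N.cutCapacity S).toReal * Real.log 2)
      + 1 / 2 * Real.log (2 * Real.pi * Real.exp 1 * ε) := by
    have e : Real.log (2 * Real.pi * Real.exp 1 * ε) = Real.log (2 * Real.pi * ε) + 1 := by
      rw [mul_right_comm, Real.log_mul (by positivity) (Real.exp_pos 1).ne', Real.log_exp]
    rw [e, hlrint]
    have h3 : ∫ ω, (la ω - lr (f ω.1, S.restrict ω.1) - A.cutLLR S q ω) ∂(A.jointLaw P)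
        = ∫ ω, la ω ∂(A.jointLaw P) - ∫ ω, lr (f ω.1, S.restrict ω.1) ∂(A.jointLaw P)
          - ∫ ω, A.cutLLR S q ω ∂(A.jointLaw P) := by
      rw [← h2]
      exact h1
    have hle' : ∫ ω, (la ω - lr (f ω.1, S.restrict ω.1) - A.cutLLR S q ω) ∂(A.jointLaw P) ≤ 0 :=
      hle
    linarith
  have hi : Integrable (fun p => -(lr p / Real.log 2)) ρ := (hlri.div_const _).neg
  have hsplit := integral_eq_lintegral_pos_part_sub_lintegral_neg_part hi
  simp only [neg_neg] at hsplit
  have hXt : ∫⁻ p, ENNReal.ofReal (-(lr p / Real.log 2)) ∂ρ ≠ ∞ :=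
    (hi.lintegral_lt_top).ne
  rw [← EReal.coe_ennreal_toReal hXt, ← EReal.coe_ennreal_toReal hYt, ← EReal.coe_sub, ← hsplit,
    integral_neg, integral_div, EReal.coe_le_coe_iff, ← neg_div, div_le_iff₀ hlog2]
  refine hfinal.trans_eq ?_
  field_simp

end Algorithm

lemma half_log2_one_div {ε : ℝ≥0} (hε : ε ≠ 0) :
    ((1 / 2 : ℝ) : EReal)
        * log2 (1 / (ENNReal.ofReal (2 * Real.pi * Real.exp 1) * (ε : ℝ≥0∞)))
      = ((-(1 / 2 * (Real.log (2 * Real.pi * Real.exp 1 * ε) / Real.log 2)) : ℝ) : EReal) := by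
  have hpos : (0 : ℝ) < ε := NNReal.coe_pos.2 (pos_iff_ne_zero.2 hε)
  have e : 1 / (ENNReal.ofReal (2 * Real.pi * Real.exp 1) * (ε : ℝ≥0∞))
      = ENNReal.ofReal (2 * Real.pi * Real.exp 1 * ε)⁻¹ := by
    rw [ENNReal.ofReal_inv_of_pos (by positivity), ENNReal.ofReal_mul (q := (ε : ℝ)) (by positivity),
      ENNReal.ofReal_coe_nnreal, one_div]
  rw [e, log2_eq_coe (ENNReal.ofReal_pos.2 (by positivity)).ne' ENNReal.ofReal_ne_top,
    ENNReal.toReal_ofReal (by positivity), Real.log_inv, ← EReal.coe_mul]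
  congr 1
  ring

lemma condDiffEntropy_add_le (A : N.Algorithm W ℝ T) (P : Measure (∀ v, W v))
    [IsProbabilityMeasure P] {S : Finset V} {v : V} (hv : v ∈ S) (hS : N.cutCapacity S ≠ ∞)
    {f : (∀ v, W v) → ℝ} (hf : Measurable f) {ε : ℝ≥0}
    (hε : A.expectedDistortion P f (fun z z' => Real.toNNReal ((z - z') ^ 2)) v ≤ (ε : ℝ≥0∞)) :
    condDiffEntropy (P.map fun x => (f x, S.restrict x)) + ((1 / 2 : ℝ) : EReal)
        * log2 (1 / (ENNReal.ofReal (2 * Real.pi * Real.exp 1) * (ε : ℝ≥0∞)))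
      ≤ (((T : ℝ≥0∞) * N.cutCapacity S : ℝ≥0∞) : EReal) := by
  have hTC : (((T : ℝ≥0∞) * N.cutCapacity S : ℝ≥0∞) : EReal)
      = ((T * (N.cutCapacity S).toReal : ℝ) : EReal) := by
    rw [← EReal.coe_ennreal_toReal (ENNReal.mul_ne_top (ENNReal.natCast_ne_top T) hS),
      ENNReal.toReal_mul, ENNReal.toReal_natCast]
  by_cases hε0 : ε = 0
  -- No Gaussian of variance zero is available. Zero error satisfies the bound for every variance `δ
  -- > 0`, and these bounds tend to `-∞`; then `-∞ + ∞ = -∞` in `EReal` settles the claim.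
  · have hbot : condDiffEntropy (P.map fun x => (f x, S.restrict x)) = ⊥ := by
      refine (EReal.eq_bot_iff_forall_lt _).2 fun y => ?_
      have hlog2 : 0 < Real.log 2 := Real.log_pos one_lt_two
      set M : ℝ := y - 1 - T * (N.cutCapacity S).toReal with hM
      -- Chosen so that half the binary logarithm of `2πeδ` is `M`, which makes the entropy bound
      -- equal to `y - 1`.
      set δ : ℝ≥0 := Real.toNNReal (Real.exp (2 * M * Real.log 2) / (2 * Real.pi * Real.exp 1))
      have hδ : (δ : ℝ) = Real.exp (2 * M * Real.log 2) / (2 * Real.pi * Real.exp 1) :=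
        Real.coe_toNNReal _ (by positivity)
      have hδ0 : δ ≠ 0 := by
        rw [← NNReal.coe_pos.trans pos_iff_ne_zero, hδ]
        positivity
      have h := A.condDiffEntropy_le P hv hS hf hδ0 (hε.trans (by simp [hε0]))
      refine h.trans_lt (EReal.coe_lt_coe_iff.2 ?_)
      have e : 2 * Real.pi * Real.exp 1 * (δ : ℝ) = Real.exp (2 * M * Real.log 2) := by
        rw [hδ]
        field_simp
      rw [e, Real.log_exp, mul_div_cancel_right₀ _ hlog2.ne']
      linarith
    rw [hbot, EReal.bot_add]
    exact bot_le
  · rw [half_log2_one_div hε0, hTC]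
    refine (add_le_add_left (A.condDiffEntropy_le P hv hS hf hε0 hε) _).trans_eq ?_
    rw [← EReal.coe_add]
    congr 1
    ring

end Network

theorem mainTheorem8 {V : Type v} [Fintype V] [DecidableEq V] (N : Network.{u} V)
    {W : V → Type w} [∀ v, MeasurableSpace (W v)]
    (P : Measure (∀ v, W v)) [IsProbabilityMeasure P] (ε : ℝ≥0) :
    (∀ (Z : Type z) [MeasurableSpace Z] [StandardBorelSpace Z]
      (f : (∀ v, W v) → Z) (_ : Measurable f)
      (d : Z → Z → ℝ≥0) (_ : Measurable (Function.uncurry d)),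
      (⨆ S : {S : Finset V // S.Nonempty},
        perCapacity
          ((rateDistortion d (P.map f) ε : EReal)
            - (mutualInfo (P.map fun x => (f x, (S : Finset V).restrict x)) : EReal))
          (N.cutCapacity S))
        ≤ ((N.Tmax P f d ε : ℝ≥0∞) : EReal)) ∧
    (∀ (f : (∀ v, W v) → ℝ) (_ : Measurable f) (_ : P.map f ≪ volume),
      (⨆ S : {S : Finset V // S.Nonempty},
        perCapacity
          (condDiffEntropy (P.map fun x => (f x, (S : Finset V).restrict x))
            + ((1 / 2 : ℝ) : EReal)
              * log2 (1 / (ENNReal.ofReal (2 * Real.pi * Real.exp 1) * (ε : ℝ≥0∞))))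
          (N.cutCapacity S))
        ≤ ((N.Tmax P f (fun z z' => Real.toNNReal ((z - z') ^ 2)) ε : ℝ≥0∞) : EReal)) := by
  refine ⟨fun Z _ _ f hf d hd => iSup_le fun S => ?_, fun f hf _ => iSup_le fun S => ?_⟩
  -- Nonemptiness of `S` supplies the node at which the accuracy requirement is used; one node in
  -- `S` suffices.
  · obtain ⟨v, hv⟩ := S.2
    refine Network.le_Tmax fun T A hA => perCapacity_le fun hS => ?_
    have h := A.rateDistortion_le P hv hS hf hd (hA v)
    refine EReal.sub_le_of_le_add' ?_
    rw [← EReal.coe_ennreal_add]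
    exact EReal.coe_ennreal_le_coe_ennreal_iff.2 h
  · obtain ⟨v, hv⟩ := S.2
    exact Network.le_Tmax fun T A hA => perCapacity_le fun hS =>
      Network.condDiffEntropy_add_le A P hv hS hf (hA v)
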